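/- Let $\beta,\gamma,c>0$, and set $\xi_0=\exp(-\beta\gamma(1-e^{-\gamma}))$ and $\sigma=(1-e^{-c})/(1-\xi_0)$. For $n^{\mathrm{DRIG}}\in\mathbb N$ let $n^{\mathrm{RIG}}=\lfloor\sigma n^{\mathrm{DRIG}}\rfloor$ and $n=n^{\mathrm{RIG}}+\lfloor e^{-c}n^{\mathrm{DRIG}}\rfloor$. Consider the graph on $n$ vertices that is the disjoint union of (i) a random intersection graph with $n^{\mathrm{RIG}}$ vertices and $\lfloor\beta n^{\mathrm{RIG}}\rfloor$ attributes, in which each vertex is connected to each attribute independently with probability $\gamma/n^{\mathrm{RIG}}$ (capped at $1$, which matters only for small $n$) and two distinct vertices are adjacent if and only if they are connected to a common attribute, and (ii) $\lfloor e^{-c}n^{\mathrm{DRIG}}\rfloor$ isolated vertices. Given this graph, run random sequential adsorption: at time $0$ all vertices are unaffected; at each time $t=1,2,\ldots,n$, as long as there is an unaffected vertex, choose one uniformly at random among the unaffected vertices, label it excited, and label all its unaffected neighbours blocked. If there is no unaffected vertex, nothing changes. Let $U(t)$ be the number of unaffected vertices at time $t$ and let $T^*=\min\{t\in\{0,1,\ldots,n\}: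 U(t)=0\}$. The system of integral equations $$\tilde u(s)=1-s-\int_0^s\gamma^2\tilde u(y)\tilde w(y)\,dy,\qquad \tilde w(s)=\beta-\int_0^s\gamma\,\tilde w(y)\,dy,\qquad 0\le s\le 1,$$ has a solution, and for every solution $(\tilde u,\tilde w)$ (with integrable integrands) the set $\{0\le s\le 1:\tilde u(s)=0\}$ has a least element $s_0$. With $$\phi=\frac{e^{-c}+\sigma s_0}{e^{-c}+\sigma}$$ one has $0\le\phi\le1$, and for every $\varepsilon>0$, $$\mathbb P\bigl(|T^*/n-\phi|\ge\varepsilon\bigr)\to0\qquad\text{as } n^{\mathrm{DRIG}}\to\infty$$ (and hence $n\to\infty$). -/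

import Mathlib

open MeasureTheory ProbabilityTheory Filter Topology

noncomputable section

namespace RSA

/-! ### Random sequential adsorption on a finite graph -/

/-- The three labels of a vertex. -/
inductive Label where
  | unaffected
  | excited
  | blocked

/-- A configuration assigns a label to each vertex. -/
abbrev Config (V : Type) : Type := V → Label

/-- The set of unaffected vertices of a configuration. -/
def unaffectedSet {V : Type} [Fintype V] (x : Config V) : Finset V := by
  classical exact Finset.univ.filter (fun v => x v = Label.unaffected)

open Classical in
/-- The vertex `v` becomes excited and all its unaffected neighbours become blocked. -/
def excite {V : Type} (G : SimpleGraph V) (x : Config V) (v : V) : Config V := fun w =>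
  if w = v then Label.excited
  else if G.Adj v w ∧ x w = Label.unaffected then Label.blocked
  else x w

open Classical in
/-- One iteration: a uniformly chosen unaffected vertex is excited; if there is no unaffected
vertex, nothing changes. -/
def step {V : Type} [Fintype V] (G : SimpleGraph V) (x : Config V) : PMF (Config V) :=
  if h : (unaffectedSet x).Nonempty then
    (PMF.uniformOfFinset (unaffectedSet x) h).map (excite G x)
  else PMF.pure x

/-- The law of the sequence of configurations at times `0, 1, …, T` (kept constant after time
`T`), started from the configuration in which every vertex is unaffected. -/
def trajectory {V : Type} [Fintype V] (G : SimpleGraph V) : ℕ → PMF (ℕ → Config V)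
  | 0 => PMF.pure (fun _ _ => Label.unaffected)
  | T + 1 => (trajectory G T).bind fun x =>
      (step G (x T)).map fun y => fun t => if t ≤ T then x t else y

/-- The number `U(t)` of unaffected vertices at time `t`. -/
def numUnaffected {V : Type} [Fintype V] (x : ℕ → Config V) (t : ℕ) : ℕ :=
  (unaffectedSet (x t)).card

/-- The hitting time `T* = min {t ∈ {0, …, n} | U(t) = 0}`. As each iteration decreases a positive
`U` by at least one, the minimum is over a nonempty set almost surely if there are `n` vertices. -/
def hittingTime {V : Type} [Fintype V] (n : ℕ) (x : ℕ → Config V) : ℕ :=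
  sInf {t : ℕ | t ≤ n ∧ numUnaffected x t = 0}

/-! ### The random intersection graph and the mixture -/

/-- The intersection graph with vertex set `Fin N` of a vertex-attribute incidence relation `A`:
two distinct vertices are adjacent if they share an attribute. -/
def intersectionGraph {N m : ℕ} (A : Set (Fin N × Fin m)) : SimpleGraph (Fin N) where
  Adj u v := u ≠ v ∧ ∃ a : Fin m, (u, a) ∈ A ∧ (v, a) ∈ A
  symm := ⟨fun _ _ h => ⟨h.1.symm, h.2.imp fun _ ha => ⟨ha.2, ha.1⟩⟩⟩
  loopless := ⟨fun _ h => h.1 rfl⟩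

/-- The connection probability `γ / N` (capped at `1`, which is relevant only if `N < γ`). -/
def connectProb (N : ℕ) (γ : ℝ) : unitInterval :=
  Set.projIcc (0 : ℝ) 1 zero_le_one (γ / N)

/-- The random incidence relation of the random intersection graph with parameters `N, β, γ`:
each of the `N` vertices is connected to each of the `⌊β N⌋` attributes independently with
probability `γ / N`. -/
def incidenceLaw (N : ℕ) (β γ : ℝ) : PMF (Set (Fin N × Fin ⌊β * N⌋₊)) :=
  (setBernoulli (Set.univ : Set (Fin N × Fin ⌊β * N⌋₊)) (connectProb N γ)).toPMF

/-- `ξ₀ = exp (-βγ(1 - e^{-γ}))`. -/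
def xi0 (β γ : ℝ) : ℝ := Real.exp (-(β * γ * (1 - Real.exp (-γ))))

/-- `σ = (1 - e^{-c}) / (1 - ξ₀)`. -/
def sigma (β γ c : ℝ) : ℝ := (1 - Real.exp (-c)) / (1 - xi0 β γ)

/-- The size `⌊σ k⌋` of the random intersection graph, where `k = n^DRIG`. -/
def nRIG (β γ c : ℝ) (k : ℕ) : ℕ := ⌊sigma β γ c * k⌋₊

/-- The number `⌊e^{-c} k⌋` of additional isolated vertices, where `k = n^DRIG`. -/
def nIso (c : ℝ) (k : ℕ) : ℕ := ⌊Real.exp (-c) * k⌋₊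

/-- The number `n` of vertices of the mixture. -/
def numVertices (β γ c : ℝ) (k : ℕ) : ℕ := nRIG β γ c k + nIso c k

/-- The law of the hitting time `T*` of random sequential adsorption on the disjoint union of a
random intersection graph and a set of isolated vertices. -/
def hittingTimeLaw (β γ c : ℝ) (k : ℕ) : PMF ℕ :=
  (incidenceLaw (nRIG β γ c k) β γ).bind fun A =>
    (trajectory (intersectionGraph A ⊕g (⊥ : SimpleGraph (Fin (nIso c k))))
      (numVertices β γ c k)).map (hittingTime (numVertices β γ c k))

/-! ### The limiting system of integral equations -/

/-- `u` and `w` solve, on `[0, 1]`, the system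
`u(s) = 1 - s - ∫₀ˢ γ² u w`, `w(s) = β - ∫₀ˢ γ w` (with integrable integrands). -/
structure IsFluidLimit (β γ : ℝ) (u w : ℝ → ℝ) : Prop where
  integrable_uw : IntervalIntegrable (fun y => γ ^ 2 * u y * w y) volume 0 1
  integrable_w : IntervalIntegrable (fun y => γ * w y) volume 0 1
  eq_u : ∀ s ∈ Set.Icc (0 : ℝ) 1, u s = 1 - s - ∫ y in (0 : ℝ)..s, γ ^ 2 * u y * w y
  eq_w : ∀ s ∈ Set.Icc (0 : ℝ) 1, w s = β - ∫ y in (0 : ℝ)..s, γ * w y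

/-- `φ = (e^{-c} + σ s₀) / (e^{-c} + σ)`. -/
def phi (β γ c s₀ : ℝ) : ℝ :=
  (Real.exp (-c) + sigma β γ c * s₀) / (Real.exp (-c) + sigma β γ c)

end RSA

end

/-! Every iteration before the hitting time excites exactly one vertex, so T* is the number of
vertices accepted by the greedy algorithm in uniformly random order (`hittingTime_eq_excitedCount`,
`countProb_eq_orderAvg`). Isolated vertices are always accepted. A vertex of the intersection graph
is accepted if and only if it has no attribute in the set D of attributes of the vertices accepted
earlier. Since the attribute sets are independent, each may be sampled only when its vertex is
examined. Hence, for every fixed order, the pair (number accepted, |D|) is a Markov chain: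
acceptance has probability (1-p)^|D|, and then D gains a binomial number of new attributes.

The fluid limit is explicit in the accepted fraction x: the density of unused attributes is
`unusedDensity` β e^{-γx}, the acceptance probability is the inverse of `inverseRate`, and the
processed fraction needed to reach x is `timeAt`, the integral of `inverseRate`. The squared
distance `distSq` of the chain from this curve grows in one step on average by at most a factor 1 +
C/N and a term C/N² (`distSq_drift`). A discrete Gronwall argument (`sum_acceptCount_timeAt_le`)
makes the mean square error O(1/N) once all N vertices are processed, uniformly in the order.
Chebyshev's inequality then puts the accepted fraction near the root s₀ of `timeAt` = 1.

For any solution of the integral equations, u · `inverseRate` + `timeAt` = 1 on [0, 1]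
(`IsFluidLimit.mul_inverseRate`), so s₀ is the only zero of u. -/

namespace RSA

open scoped ENNReal

/-! ### Reduction of the hitting time to a count of excited vertices. -/

section Dynamics

variable {V : Type}

open Classical in
/-- The elements of `S` that remain unaffected after `v` is excited. -/
noncomputable def remove (G : SimpleGraph V) (S : Finset V) (v : V) : Finset V :=
  S.filter fun w => w ≠ v ∧ ¬ G.Adj v w

theorem mem_remove {G : SimpleGraph V} {S : Finset V} {v w : V} :
    w ∈ remove G S v ↔ w ∈ S ∧ w ≠ v ∧ ¬ G.Adj v w := by
  classical
  simp [remove]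

theorem card_remove_lt {G : SimpleGraph V} {S : Finset V} {v : V} (hv : v ∈ S) :
    (remove G S v).card < S.card := by
  apply Finset.card_lt_card
  refine ⟨fun w hw => (mem_remove.1 hw).1, fun h => ?_⟩
  exact (mem_remove.1 (h hv)).2.1 rfl

open Classical in
/-- The probability that the number of further excitations of random sequential adsorption, run
for `k` iterations with unaffected set `S`, added to `m`, is in `B`. -/
noncomputable def countProb (G : SimpleGraph V) (B : Set ℕ) : ℕ → Finset V → ℕ → ℝ≥0∞
  | 0, _, m => B.indicator 1 m
  | k + 1, S, m => if S.Nonempty then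
      (S.card : ℝ≥0∞)⁻¹ * ∑ v ∈ S, countProb G B k (remove G S v) (m + 1)
    else B.indicator 1 m

theorem countProb_empty (G : SimpleGraph V) (B : Set ℕ) (k m : ℕ) :
    countProb G B k ∅ m = B.indicator 1 m := by
  cases k <;> simp [countProb]

variable [Fintype V]

theorem mem_unaffectedSet {x : Config V} {v : V} :
    v ∈ unaffectedSet x ↔ x v = Label.unaffected := by
  classical
  simp [unaffectedSet]

open Classical in
/-- The number of excited vertices of a configuration. -/
noncomputable def excitedCount (x : Config V) : ℕ :=
  (Finset.univ.filter fun v => x v = Label.excited).card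

theorem unaffectedSet_excite (G : SimpleGraph V) (x : Config V) (v : V) :
    unaffectedSet (excite G x v) = remove G (unaffectedSet x) v := by
  ext w
  rw [mem_unaffectedSet, mem_remove, mem_unaffectedSet, excite]
  split_ifs with h1 h2
  · simp [h1]
  · simp [h2.1]
  · have : x w = Label.unaffected → ¬ G.Adj v w := fun h h' => h2 ⟨h', h⟩
    simp only [ne_eq, h1, not_false_eq_true, true_and]
    exact ⟨fun h => ⟨h, this h⟩, fun h => h.1⟩

theorem excitedCount_excite (G : SimpleGraph V) {x : Config V} {v : V}
    (hv : v ∈ unaffectedSet x) : excitedCount (excite G x v) = excitedCount x + 1 := by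
  classical
  rw [mem_unaffectedSet] at hv
  unfold excitedCount
  rw [← Finset.card_insert_of_notMem (a := v) (by simp [hv])]
  congr 1
  ext w
  rw [Finset.mem_insert, Finset.mem_filter_univ, Finset.mem_filter_univ]
  unfold excite
  split_ifs with h1 h2
  · simp [h1]
  · simp [h1, h2.2]
  · simp [h1]

theorem mem_support_step {G : SimpleGraph V} {x y : Config V} (h : y ∈ (step G x).support) :
    (∃ v ∈ unaffectedSet x, y = excite G x v) ∨ (unaffectedSet x = ∅ ∧ y = x) := by
  unfold step at h
  split_ifs at h with hx
  · rw [PMF.mem_support_map_iff] at h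
    obtain ⟨v, hv, rfl⟩ := h
    rw [PMF.mem_support_uniformOfFinset_iff] at hv
    exact Or.inl ⟨v, hv, rfl⟩
  · rw [PMF.mem_support_pure_iff] at h
    exact Or.inr ⟨Finset.not_nonempty_iff_eq_empty.1 hx, h⟩

theorem mem_support_trajectory {G : SimpleGraph V} {T : ℕ} {x : ℕ → Config V}
    (h : x ∈ (trajectory G T).support) :
    x 0 = (fun _ => Label.unaffected) ∧ ∀ t < T, x (t + 1) ∈ (step G (x t)).support := by
  induction T generalizing x with
  | zero =>
    rw [trajectory, PMF.mem_support_pure_iff] at h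
    subst h
    simp
  | succ T ih =>
    rw [trajectory, PMF.mem_support_bind_iff] at h
    obtain ⟨z, hz, h⟩ := h
    rw [PMF.mem_support_map_iff] at h
    obtain ⟨y, hy, rfl⟩ := h
    obtain ⟨h0, h1⟩ := ih hz
    refine ⟨by simpa using h0, fun t ht => ?_⟩
    rcases Nat.lt_succ_iff_lt_or_eq.1 ht with h | rfl
    · simpa [h.le, Nat.succ_le_of_lt h] using h1 t h
    · simpa using hy

/-- Up to the hitting time each iteration excites one vertex and lowers U by at least one, so U(t) +
t ≤ n and zero is reached by time n. Afterwards the configuration is frozen, so the count at time n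
is the count at the hitting time. -/
theorem hittingTime_eq_excitedCount {G : SimpleGraph V} {n : ℕ} (hn : Fintype.card V ≤ n)
    {x : ℕ → Config V} (h : x ∈ (trajectory G n).support) :
    hittingTime n x = excitedCount (x n) := by
  obtain ⟨h0, h1⟩ := mem_support_trajectory h
  have key : ∀ t ≤ n, (∀ s < t, numUnaffected x s ≠ 0) →
      excitedCount (x t) = t ∧ numUnaffected x t + t ≤ n := by
    intro t
    induction t with
    | zero =>
      intro _ _
      refine ⟨by simp [excitedCount, h0], ?_⟩
      exact (Finset.card_le_univ _).trans hn
    | succ t ih =>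
      intro ht hs
      obtain ⟨h2, h3⟩ := ih (by omega) fun s hs' => hs s (by omega)
      rcases mem_support_step (h1 t (by omega)) with ⟨v, hv, hy⟩ | ⟨he, -⟩
      · refine ⟨by rw [hy, excitedCount_excite G hv, h2], ?_⟩
        have := card_remove_lt (G := G) hv
        unfold numUnaffected at h3 ⊢
        rw [hy, unaffectedSet_excite]
        omega
      · exact absurd (by simp [numUnaffected, he]) (hs t (by omega))
  have hne : {t : ℕ | t ≤ n ∧ numUnaffected x t = 0}.Nonempty := by
    by_contra hcon
    have hs : ∀ s < n, numUnaffected x s ≠ 0 := fun s hs h => hcon ⟨s, hs.le, h⟩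
    have := (key n le_rfl hs).2
    exact hcon ⟨n, le_rfl, by omega⟩
  obtain ⟨hle, hz⟩ : hittingTime n x ≤ n ∧ numUnaffected x (hittingTime n x) = 0 :=
    Nat.sInf_mem hne
  have hmin : ∀ s < hittingTime n x, numUnaffected x s ≠ 0 := fun s hs hz' =>
    Nat.notMem_of_lt_sInf hs ⟨(hs.trans_le hle).le, hz'⟩
  have hconst : ∀ k, hittingTime n x + k ≤ n → x (hittingTime n x + k) = x (hittingTime n x) := by
    intro k
    induction k with
    | zero => simp
    | succ k ih =>
      intro hk
      have h2 := ih (by omega)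
      rcases mem_support_step (h1 (hittingTime n x + k) (by omega)) with ⟨v, hv, -⟩ | ⟨-, he⟩
      · rw [h2] at hv
        have : (unaffectedSet (x (hittingTime n x))).card = 0 := hz
        rw [Finset.card_eq_zero] at this
        simp [this] at hv
      · rw [← add_assoc, he, h2]
  have h3 := hconst (n - hittingTime n x) (by omega)
  rw [Nat.add_sub_cancel' hle] at h3
  rw [h3]
  exact (key _ hle hmin).1.symm

/-- The law of the configuration after a number of iterations. -/
noncomputable def runSteps (G : SimpleGraph V) : ℕ → Config V → PMF (Config V)
  | 0, x => PMF.pure x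
  | T + 1, x => (step G x).bind (runSteps G T)

/-- `trajectory` appends its step at the end, whereas the recursion of `countProb` splits off the
first step; this reconciles the two. -/
theorem runSteps_succ' (G : SimpleGraph V) (T : ℕ) (x : Config V) :
    runSteps G (T + 1) x = (runSteps G T x).bind (step G) := by
  induction T generalizing x with
  | zero =>
    rw [runSteps, runSteps, PMF.pure_bind]
    exact PMF.bind_pure _
  | succ T ih =>
    rw [runSteps]
    conv_rhs => rw [runSteps, PMF.bind_bind]
    congr 1
    funext y
    exact ih y

theorem trajectory_map_eval (G : SimpleGraph V) (T : ℕ) :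
    (trajectory G T).map (fun x => x T) = runSteps G T (fun _ => Label.unaffected) := by
  induction T with
  | zero => rw [trajectory, PMF.pure_map, runSteps]
  | succ T ih =>
    rw [trajectory, PMF.map_bind, runSteps_succ', ← ih, PMF.bind_map]
    congr 1
    funext x
    rw [PMF.map_comp, Function.comp_apply]
    convert PMF.map_id _ using 2
    funext y
    simp

theorem pmf_map_congr {α β : Type*} {p : PMF α} {f g : α → β} (h : ∀ a ∈ p.support, f a = g a) :
    p.map f = p.map g := by
  ext b
  classical
  rw [PMF.map_apply, PMF.map_apply]
  refine tsum_congr fun a => ?_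
  by_cases ha : a ∈ p.support
  · rw [h a ha]
  · rw [PMF.mem_support_iff, not_not] at ha
    simp [ha]

/-- The unaffected set together with the number of excited vertices is itself a Markov chain, so the
other labels can be forgotten. -/
theorem toMeasure_runSteps_map (G : SimpleGraph V) (B : Set ℕ) (k : ℕ) (x : Config V) :
    ((runSteps G k x).map excitedCount).toMeasure B =
      countProb G B k (unaffectedSet x) (excitedCount x) := by
  classical
  induction k generalizing x with
  | zero =>
    rw [runSteps, PMF.pure_map, PMF.toMeasure_pure_apply _ _ (MeasurableSet.of_discrete)]
    simp [countProb, Set.indicator]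
  | succ k ih =>
    rw [runSteps, countProb]
    split_ifs with hS
    · rw [step, dif_pos hS, PMF.bind_map, PMF.map_bind,
        PMF.toMeasure_bind_apply _ _ _ MeasurableSet.of_discrete]
      simp only [Function.comp_apply, ih, PMF.uniformOfFinset_apply]
      rw [tsum_fintype, Finset.mul_sum, ← Finset.sum_filter_add_sum_filter_not _
        (fun v => v ∈ unaffectedSet x)]
      rw [Finset.sum_eq_zero (s := Finset.univ.filter fun v => v ∉ unaffectedSet x), add_zero]
      · rw [Finset.filter_univ_mem]
        refine Finset.sum_congr rfl fun v hv => ?_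
        rw [if_pos hv, unaffectedSet_excite, excitedCount_excite G hv]
      · intro v hv
        rw [Finset.mem_filter] at hv
        simp [hv.2]
    · rw [step, dif_neg hS, PMF.pure_bind, ih]
      rw [Finset.not_nonempty_iff_eq_empty] at hS
      rw [hS, countProb_empty]

theorem toMeasure_trajectory_map_hittingTime (G : SimpleGraph V) {n : ℕ}
    (hn : Fintype.card V ≤ n) (B : Set ℕ) :
    ((trajectory G n).map (hittingTime n)).toMeasure B = countProb G B n Finset.univ 0 := by
  rw [pmf_map_congr fun x hx => hittingTime_eq_excitedCount hn hx,
    show (fun x : ℕ → Config V => excitedCount (x n)) = excitedCount ∘ (fun x => x n) from rfl,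
    ← PMF.map_comp, trajectory_map_eval, toMeasure_runSteps_map]
  congr 1
  · ext v; simp [mem_unaffectedSet]
  · simp [excitedCount]

end Dynamics

/-! ### Random sequential adsorption as a greedy algorithm in random order. -/

section Orderings

variable {V : Type}

open Classical in
/-- The average of `h` over all orderings of the `k`-element set `R`. -/
noncomputable def orderAvg : ℕ → Finset V → (List V → ℝ≥0∞) → ℝ≥0∞
  | 0, _, h => h []
  | k + 1, R, h => (R.card : ℝ≥0∞)⁻¹ * ∑ v ∈ R, orderAvg k (R.erase v) (fun l => h (v :: l))

/-- Exchanges the averages over the random graph and over the order; with `orderAvg_le`, a bound for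
each fixed order suffices. -/
theorem orderAvg_sum {ι : Type*} (s : Finset ι) (w : ι → ℝ≥0∞) (k : ℕ) (R : Finset V)
    (h : ι → List V → ℝ≥0∞) :
    ∑ i ∈ s, w i * orderAvg k R (h i) = orderAvg k R (fun l => ∑ i ∈ s, w i * h i l) := by
  induction k generalizing R h with
  | zero => rfl
  | succ k ih =>
    simp only [orderAvg]
    simp_rw [← ih]
    rw [Finset.sum_comm, Finset.mul_sum]
    refine Finset.sum_congr rfl fun i _ => ?_
    rw [← Finset.mul_sum]
    ring

theorem orderAvg_le {k : ℕ} {R : Finset V} (hR : R.card = k) {h : List V → ℝ≥0∞} {b : ℝ≥0∞}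
    (hb : ∀ l : List V, l.Nodup → (∀ v, v ∈ l ↔ v ∈ R) → h l ≤ b) : orderAvg k R h ≤ b := by
  classical
  induction k generalizing R h with
  | zero =>
    rw [Finset.card_eq_zero] at hR
    exact hb [] List.nodup_nil (by simp [hR])
  | succ k ih =>
    have h1 : ∀ v ∈ R, orderAvg k (R.erase v) (fun l => h (v :: l)) ≤ b := by
      intro v hv
      apply ih (by rw [Finset.card_erase_of_mem hv, hR]; rfl)
      intro l hl hm
      apply hb
      · rw [List.nodup_cons]
        exact ⟨by simp [hm], hl⟩
      · intro w
        by_cases hw : w = v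
        · simp [hw, hv]
        · simp [hw, hm]
    have h0 : (R.card : ℝ≥0∞) ≠ 0 := by rw [hR]; simp
    calc orderAvg (k + 1) R h ≤ (R.card : ℝ≥0∞)⁻¹ * ∑ v ∈ R, b := by
          unfold orderAvg
          gcongr with v hv
          convert h1 v hv
      _ = b := by
          rw [Finset.sum_const, nsmul_eq_mul, ← mul_assoc,
            ENNReal.inv_mul_cancel h0 (ENNReal.natCast_ne_top _), one_mul]

open Classical in
/-- The number of vertices accepted by the greedy algorithm that goes through the list `l` with
initial unaffected set `S`. -/
noncomputable def greedyCount [Fintype V] (G : SimpleGraph V) : List V → Finset V → ℕ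
  | [], _ => 0
  | v :: l, S => if v ∈ S then greedyCount G l (remove G S v) + 1 else greedyCount G l S

/-- Random sequential adsorption is the greedy algorithm in uniformly random order. -/
theorem countProb_eq_orderAvg [Fintype V] (G : SimpleGraph V) (B : Set ℕ) {k k' m : ℕ}
    {R S : Finset V} (hR : R.card = k) (hS : S ⊆ R) (hk : S.card ≤ k') :
    countProb G B k' S m =
      orderAvg k R (fun l => B.indicator 1 (greedyCount G l S + m)) := by
  classical
  induction k generalizing k' m R S with
  | zero =>
    rw [Finset.card_eq_zero] at hR
    subst hR
    rw [Finset.subset_empty] at hS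
    subst hS
    simp [countProb_empty, orderAvg, greedyCount]
  | succ k ih =>
    -- The next vertex in the order is either still unaffected and is accepted, using up one
    -- iteration, or is skipped at no cost. Conditionally on the first case it is uniform on `S`, as
    -- in the adsorption process.
    have hin : ∀ v ∈ S, orderAvg k (R.erase v)
        (fun l => B.indicator 1 (greedyCount G (v :: l) S + m)) =
        countProb G B (k' - 1) (remove G S v) (m + 1) := by
      intro v hv
      have hlt := card_remove_lt (G := G) hv
      rw [ih (R := R.erase v) (by rw [Finset.card_erase_of_mem (hS hv), hR]; rfl) _ (by omega)]
      · simp only [greedyCount, if_pos hv, add_assoc, add_comm 1 m]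
      · intro w hw
        rw [mem_remove] at hw
        exact Finset.mem_erase.2 ⟨hw.2.1, hS hw.1⟩
    have hout : ∀ v ∈ R \ S, orderAvg k (R.erase v)
        (fun l => B.indicator 1 (greedyCount G (v :: l) S + m)) = countProb G B k' S m := by
      intro v hv
      rw [Finset.mem_sdiff] at hv
      rw [ih (R := R.erase v) (by rw [Finset.card_erase_of_mem hv.1, hR]; rfl) _ hk]
      · simp only [greedyCount, if_neg hv.2]
      · intro w hw
        exact Finset.mem_erase.2 ⟨fun h => hv.2 (h ▸ hw), hS hw⟩
    have hsum : ∑ v ∈ S, countProb G B (k' - 1) (remove G S v) (m + 1) =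
        S.card * countProb G B k' S m := by
      rcases S.eq_empty_or_nonempty with rfl | hne
      · simp
      · obtain ⟨j, rfl⟩ : ∃ j, k' = j + 1 := ⟨k' - 1, by have := hne.card_pos; omega⟩
        have h0 : (S.card : ℝ≥0∞) ≠ 0 := by simpa using hne.ne_empty
        rw [countProb, if_pos hne, ← mul_assoc,
          ENNReal.mul_inv_cancel h0 (ENNReal.natCast_ne_top _), one_mul]
        rfl
    have h0 : (R.card : ℝ≥0∞) ≠ 0 := by rw [hR]; simp
    rw [orderAvg]
    -- The skipped vertices contribute |R \ S| copies of the left-hand side and the accepted ones,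
    -- by averaging over `S`, another |S| copies.
    have hsplit : ∑ v ∈ R, orderAvg k (R.erase v)
        (fun l => B.indicator 1 (greedyCount G (v :: l) S + m)) =
        R.card * countProb G B k' S m := by
      rw [← Finset.sum_sdiff hS, Finset.sum_congr rfl hout, Finset.sum_congr rfl hin, hsum,
        Finset.sum_const, nsmul_eq_mul, ← add_mul, ← Nat.cast_add,
        Finset.card_sdiff_add_card_eq_card hS]
    calc countProb G B k' S m = (R.card : ℝ≥0∞)⁻¹ * (R.card * countProb G B k' S m) := by
          rw [← mul_assoc, ENNReal.inv_mul_cancel h0 (ENNReal.natCast_ne_top _), one_mul]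
      _ = _ := by
          rw [← hsplit]

end Orderings

/-! ### The greedy algorithm on an intersection graph in terms of used attributes. -/

section Incidence

variable {α β : Type} [DecidableEq β]

/-- The number of vertices accepted by the greedy algorithm on the intersection graph with
attribute sets `ρ`, going through the list `l`, if `D` is the set of attributes already used. -/
def acceptCount (ρ : α → Finset β) : List α → Finset β → ℕ
  | [], _ => 0
  | v :: l, D => if Disjoint (ρ v) D then acceptCount ρ l (D ∪ ρ v) + 1 else acceptCount ρ l D

theorem acceptCount_update [DecidableEq α] (ρ : α → Finset β) {v : α} (r : Finset β) {l : List α}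
    (hv : v ∉ l) (D : Finset β) :
    acceptCount (Function.update ρ v r) l D = acceptCount ρ l D := by
  induction l generalizing D with
  | nil => rfl
  | cons u l ih =>
    rw [List.mem_cons, not_or] at hv
    rw [acceptCount, acceptCount, ih hv.2, ih hv.2, Function.update_of_ne (Ne.symm hv.1)]

end Incidence

open Classical in
/-- The set of attributes of a vertex. -/
noncomputable def attributes {N m : ℕ} (A : Set (Fin N × Fin m)) (u : Fin N) : Finset (Fin m) :=
  Finset.univ.filter fun a => (u, a) ∈ A

theorem mem_attributes {N m : ℕ} {A : Set (Fin N × Fin m)} {u : Fin N} {a : Fin m} :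
    a ∈ attributes A u ↔ (u, a) ∈ A := by
  simp [attributes]

/-- The greedy count on the union of an intersection graph and isolated vertices. -/
theorem greedyCount_sum_bot {N m I : ℕ} (A : Set (Fin N × Fin m)) {l : List (Fin N ⊕ Fin I)}
    (hl : l.Nodup) {S : Finset (Fin N ⊕ Fin I)} {D : Finset (Fin m)}
    (h1 : ∀ u, Sum.inl u ∈ l → (Sum.inl u ∈ S ↔ Disjoint (attributes A u) D))
    (h2 : ∀ i, Sum.inr i ∈ l → Sum.inr i ∈ S) :
    greedyCount (intersectionGraph A ⊕g (⊥ : SimpleGraph (Fin I))) l S =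
      (l.filterMap Sum.getRight?).length +
        acceptCount (attributes A) (l.filterMap Sum.getLeft?) D := by
  induction l generalizing S D with
  | nil => simp [greedyCount, acceptCount]
  | cons v l ih =>
    rw [List.nodup_cons] at hl
    rcases v with u | i
    · rw [greedyCount]
      simp only [List.filterMap_cons, Sum.getRight?_inl, Sum.getLeft?_inl, acceptCount]
      by_cases hu : Disjoint (attributes A u) D
      · rw [if_pos hu, if_pos ((h1 u (by simp)).2 hu), ih hl.2 (D := D ∪ attributes A u), add_assoc]
        -- Invariant: among the vertices still in the list, the unaffected ones are those whose
        -- attributes avoid `D`. Adjacency to `u` means sharing an attribute with `u`, so replacing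
        -- `D` by `D ∪ attributes A u` preserves it.
        · intro w hw
          have hne : w ≠ u := by rintro rfl; exact hl.1 hw
          rw [mem_remove, h1 w (List.mem_cons_of_mem _ hw), Finset.disjoint_union_right,
            SimpleGraph.sum_adj_inl]
          refine and_congr_right fun _ => ?_
          simp only [ne_eq, Sum.inl.injEq, hne, not_false_eq_true, true_and, intersectionGraph,
            Finset.disjoint_left, mem_attributes]
          constructor
          · intro h a h3 h4
            exact h ⟨Ne.symm hne, a, h4, h3⟩
          · rintro h ⟨-, a, h3, h4⟩
            exact h h4 h3
        · intro i hi
          rw [mem_remove]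
          exact ⟨h2 i (List.mem_cons_of_mem _ hi), by simp, by simp [SimpleGraph.sum]⟩
      · rw [if_neg hu, if_neg fun h => hu ((h1 u (by simp)).1 h), ih hl.2]
        · exact fun w hw => h1 w (List.mem_cons_of_mem _ hw)
        · exact fun i hi => h2 i (List.mem_cons_of_mem _ hi)
    · rw [greedyCount, if_pos (h2 i (by simp)), ih hl.2 (D := D)]
      · simp only [List.filterMap_cons, Sum.getRight?_inr, Sum.getLeft?_inr, List.length_cons]
        ring
      · intro w hw
        rw [mem_remove, h1 w (List.mem_cons_of_mem _ hw)]
        simp [SimpleGraph.sum]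
      · intro j hj
        rw [mem_remove]
        refine ⟨h2 j (List.mem_cons_of_mem _ hj), ?_, by simp⟩
        rintro h
        exact hl.1 (h ▸ hj)

theorem nodup_filterMap_getLeft {α β : Type} {l : List (α ⊕ β)} (hl : l.Nodup) :
    (l.filterMap Sum.getLeft?).Nodup := by
  refine hl.filterMap ?_
  rintro (a | a) (b | b) c <;> simp
  rintro rfl rfl; rfl

theorem nodup_filterMap_getRight {α β : Type} {l : List (α ⊕ β)} (hl : l.Nodup) :
    (l.filterMap Sum.getRight?).Nodup := by
  refine hl.filterMap ?_
  rintro (a | a) (b | b) c <;> simp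
  rintro rfl rfl; rfl

theorem length_eq_card_of_nodup {α : Type} [Fintype α] {l : List α} (hl : l.Nodup)
    (h : ∀ a, a ∈ l) : l.length = Fintype.card α := by
  classical
  rw [← List.toFinset_card_of_nodup hl]
  exact congrArg Finset.card (Finset.eq_univ_iff_forall.2 fun a => List.mem_toFinset.2 (h a))

/-! ### Deferred sampling of the attribute sets and the potential method. -/

/-- The expectation under a binomial law. -/
noncomputable def binomialMean (n : ℕ) (p : ℝ) (f : ℕ → ℝ) : ℝ :=
  ∑ k ∈ Finset.range (n + 1), (n.choose k : ℝ) * p ^ k * (1 - p) ^ (n - k) * f k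

/-- The moment identities for Bernstein polynomials give the first two binomial moments. Quadratics
suffice because `distSq` is quadratic in the number of unused attributes. -/
theorem binomialMean_quadratic (n : ℕ) (p a b c : ℝ) :
    binomialMean n p (fun k => a + b * k + c * (k : ℝ) ^ 2) =
      a + b * (n * p) + c * ((n * p) ^ 2 + n * p * (1 - p)) := by
  have h0 := congrArg (Polynomial.eval p) (bernsteinPolynomial.sum ℝ n)
  have h1 := congrArg (Polynomial.eval p) (bernsteinPolynomial.sum_smul ℝ n)
  have h2 := congrArg (Polynomial.eval p) (bernsteinPolynomial.sum_mul_smul ℝ n)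
  simp only [Polynomial.eval_finsetSum, nsmul_eq_mul, Polynomial.eval_mul, Polynomial.eval_natCast,
    Polynomial.eval_X, Polynomial.eval_one, Polynomial.eval_pow, bernsteinPolynomial,
    Polynomial.eval_sub] at h0 h1 h2
  have hc : ∀ k : ℕ, ((k * (k - 1) : ℕ) : ℝ) = (k : ℝ) ^ 2 - k := by
    intro k
    rcases k with _ | k
    · simp
    · rw [Nat.add_sub_cancel]
      push_cast
      ring
  simp only [hc] at h2
  calc _ = a * ∑ k ∈ Finset.range (n + 1), (n.choose k : ℝ) * p ^ k * (1 - p) ^ (n - k) +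
        (b + c) * ∑ k ∈ Finset.range (n + 1),
          (k : ℝ) * ((n.choose k : ℝ) * p ^ k * (1 - p) ^ (n - k)) +
        c * ∑ k ∈ Finset.range (n + 1),
          ((k : ℝ) ^ 2 - k) * ((n.choose k : ℝ) * p ^ k * (1 - p) ^ (n - k)) := by
        rw [binomialMean, Finset.mul_sum, Finset.mul_sum, Finset.mul_sum,
          ← Finset.sum_add_distrib, ← Finset.sum_add_distrib]
        refine Finset.sum_congr rfl fun k _ => by ring
    _ = _ := by
        rw [h0, h1, h2]
        ring

theorem binomialMean_const (n : ℕ) (p a : ℝ) : binomialMean n p (fun _ => a) = a := by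
  simpa using binomialMean_quadratic n p a 0 0

section Weights

variable {α β : Type} [Fintype β]

/-- The probability of an attribute set. -/
def rowWeight (p : ℝ) (r : Finset β) : ℝ := p ^ r.card * (1 - p) ^ (Fintype.card β - r.card)

theorem rowWeight_nonneg {p : ℝ} (h0 : 0 ≤ p) (h1 : p ≤ 1) (r : Finset β) : 0 ≤ rowWeight p r :=
  mul_nonneg (pow_nonneg h0 _) (pow_nonneg (sub_nonneg.2 h1) _)

theorem sum_rowWeight (p : ℝ) : ∑ r : Finset β, rowWeight p r = 1 := by
  unfold rowWeight
  rw [Fintype.sum_pow_mul_eq_add_pow]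
  simp

variable [Fintype α] [DecidableEq α]

/-- Exchanging the row of `v` with an independent copy is a weight-preserving involution on pairs
(family of rows, extra row). -/
theorem sum_prod_resample (q : Finset β → ℝ) (hq : ∑ r, q r = 1) (v : α)
    (F : (α → Finset β) → ℝ) :
    ∑ ρ : α → Finset β, (∏ u, q (ρ u)) * F ρ =
      ∑ ρ : α → Finset β, (∏ u, q (ρ u)) * ∑ r, q r * F (Function.update ρ v r) := by
  have h1 : ∑ ρ : α → Finset β, (∏ u, q (ρ u)) * F ρ =
      ∑ x : (α → Finset β) × Finset β, (∏ u, q (x.1 u)) * q x.2 * F x.1 := by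
    rw [Fintype.sum_prod_type]
    refine Finset.sum_congr rfl fun ρ _ => ?_
    simp only
    rw [← Finset.sum_mul, ← Finset.mul_sum, hq, mul_one]
  rw [h1]
  simp_rw [Finset.mul_sum]
  rw [← Fintype.sum_prod_type
    (f := fun x : (α → Finset β) × Finset β => (∏ u, q (x.1 u)) *
      (q x.2 * F (Function.update x.1 v x.2)))]
  refine Finset.sum_nbij' (fun x => (Function.update x.1 v x.2, x.1 v))
    (fun x => (Function.update x.1 v x.2, x.1 v)) (by simp) (by simp) (by simp) (by simp) ?_
  rintro ⟨ρ, r⟩ -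
  simp only [Function.update_idem, Function.update_eq_self]
  have h2 : ∏ u ∈ Finset.univ.erase v, q (Function.update ρ v r u) =
      ∏ u ∈ Finset.univ.erase v, q (ρ u) := by
    refine Finset.prod_congr rfl fun u hu => ?_
    rw [Function.update_of_ne (Finset.ne_of_mem_erase hu)]
  rw [← Finset.mul_prod_erase _ _ (Finset.mem_univ v),
    ← Finset.mul_prod_erase _ (fun u => q (Function.update ρ v r u)) (Finset.mem_univ v),
    Function.update_self, h2]
  ring

variable [DecidableEq β]

/-- A row misses `D` with probability (1-p)^|D|, and given this its size is binomial on the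
complement of `D`. -/
theorem sum_rowWeight_disjoint (p : ℝ) (D : Finset β) (f : ℕ → ℝ) :
    ∑ r : Finset β, (if Disjoint r D then rowWeight p r * f (D ∪ r).card else 0) =
      (1 - p) ^ D.card * binomialMean (Fintype.card β - D.card) p (fun k => f (D.card + k)) := by
  rw [← Finset.sum_filter]
  have h : (Finset.univ.filter fun r : Finset β => Disjoint r D) = Dᶜ.powerset := by
    ext r
    simp [Finset.subset_compl_iff_disjoint_right]
  rw [h, binomialMean, ← Finset.card_compl, Finset.mul_sum]
  rw [Finset.sum_congr rfl (g := fun r => (1 - p) ^ D.card *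
    (p ^ r.card * (1 - p) ^ (Dᶜ.card - r.card) * f (D.card + r.card)))]
  · rw [Finset.sum_powerset_apply_card (fun k => (1 - p) ^ D.card *
      (p ^ k * (1 - p) ^ (Dᶜ.card - k) * f (D.card + k)))]
    refine Finset.sum_congr rfl fun k _ => ?_
    rw [nsmul_eq_mul]
    ring
  · intro r hr
    rw [Finset.mem_powerset] at hr
    have hc := Finset.card_le_card hr
    have hd : Disjoint D r := (Finset.subset_compl_iff_disjoint_right.1 hr).symm
    rw [Finset.card_union_of_disjoint hd, rowWeight]
    have : Fintype.card β - r.card = D.card + (Dᶜ.card - r.card) := by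
      have := D.card_compl_add_card
      omega
    rw [this, pow_add]
    ring

/-- A potential that decreases on average in each step of the greedy algorithm bounds the
expectation of a function of the number of accepted vertices. -/
theorem sum_acceptCount_le {p : ℝ} (h0 : 0 ≤ p) (h1 : p ≤ 1) (F : ℕ → ℝ) (Ψ : ℕ → ℕ → ℕ → ℝ)
    (hF : ∀ e, ∀ d ≤ Fintype.card β, F e ≤ Ψ 0 e d)
    (hΨ : ∀ j e, ∀ d ≤ Fintype.card β, (1 - (1 - p) ^ d) * Ψ j e d +
      (1 - p) ^ d * binomialMean (Fintype.card β - d) p (fun k => Ψ j (e + 1) (d + k)) ≤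
        Ψ (j + 1) e d)
    {l : List α} (hl : l.Nodup) (e : ℕ) (D : Finset β) :
    ∑ ρ : α → Finset β, (∏ u, rowWeight p (ρ u)) * F (e + acceptCount ρ l D) ≤
      Ψ l.length e D.card := by
  have hw : ∑ ρ : α → Finset β, (∏ u, rowWeight p (ρ u)) = 1 := by
    have := Finset.prod_univ_sum (fun _ : α => (Finset.univ : Finset (Finset β)))
      (fun _ r => rowWeight p r)
    simp only [sum_rowWeight, Finset.prod_const_one, Fintype.piFinset_univ] at this
    exact this.symm
  induction l generalizing e D with
  | nil =>
    simp only [acceptCount, add_zero, List.length_nil]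
    rw [← Finset.sum_mul, hw, one_mul]
    exact hF e _ (Finset.card_le_univ D)
  | cons v l ih =>
    rw [List.nodup_cons] at hl
    -- The row of `v` is drawn afresh when `v` is examined. As `v` does not recur in `l`, the rest
    -- of the run never looks at it, and the induction hypothesis applies for each value `r` of the
    -- row.
    rw [sum_prod_resample (rowWeight p) (sum_rowWeight p) v]
    simp only [acceptCount, Function.update_self, acceptCount_update _ _ hl.1]
    simp_rw [Finset.mul_sum]
    rw [Finset.sum_comm]
    have key : ∀ r : Finset β, ∑ ρ : α → Finset β, (∏ u, rowWeight p (ρ u)) * (rowWeight p r *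
        F (e + if Disjoint r D then acceptCount ρ l (D ∪ r) + 1 else acceptCount ρ l D)) ≤
        (if Disjoint r D then rowWeight p r * Ψ l.length (e + 1) (D ∪ r).card else 0) +
        (rowWeight p r - (if Disjoint r D then rowWeight p r * 1 else 0)) *
          Ψ l.length e D.card := by
      intro r
      have hr := rowWeight_nonneg h0 h1 r
      simp_rw [mul_left_comm _ (rowWeight p r), ← Finset.mul_sum]
      split_ifs with hd
      · rw [mul_one, sub_self, zero_mul, add_zero]
        refine mul_le_mul_of_nonneg_left ?_ hr
        refine le_trans (le_of_eq ?_) (ih hl.2 (e + 1) (D ∪ r))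
        refine Finset.sum_congr rfl fun ρ _ => ?_
        rw [add_right_comm, add_assoc]
      · rw [sub_zero, zero_add]
        exact mul_le_mul_of_nonneg_left (ih hl.2 e D) hr
    refine (Finset.sum_le_sum fun r _ => key r).trans ?_
    rw [Finset.sum_add_distrib, ← Finset.sum_mul, Finset.sum_sub_distrib,
      sum_rowWeight_disjoint p D (fun d => Ψ l.length (e + 1) d),
      sum_rowWeight_disjoint p D (fun _ => 1), sum_rowWeight]
    rw [binomialMean_const, mul_one, add_comm]
    exact hΨ l.length e D.card (Finset.card_le_univ D)

end Weights

/-! ### The fluid limit as a function of the accepted fraction, and one-step estimates. -/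

theorem abs_exp_sub_exp_le {a b K : ℝ} (ha : a ≤ K) (hb : b ≤ K) :
    |Real.exp a - Real.exp b| ≤ Real.exp K * |a - b| := by
  wlog h : b ≤ a generalizing a b
  · rw [abs_sub_comm, abs_sub_comm a b]
    exact this hb ha (le_of_not_ge h)
  rw [abs_of_nonneg (sub_nonneg.2 (Real.exp_le_exp.2 h)), abs_of_nonneg (sub_nonneg.2 h)]
  calc Real.exp a - Real.exp b = Real.exp a * (1 - Real.exp (b - a)) := by
        rw [mul_sub, ← Real.exp_add]; ring_nf
    _ ≤ Real.exp a * (a - b) := by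
        refine mul_le_mul_of_nonneg_left ?_ (Real.exp_pos _).le
        linarith [Real.add_one_le_exp (b - a)]
    _ ≤ Real.exp K * (a - b) :=
        mul_le_mul_of_nonneg_right (Real.exp_le_exp.2 ha) (sub_nonneg.2 h)

/-- The limiting density of unused attributes. -/
noncomputable def unusedDensity (β γ x : ℝ) : ℝ := β * Real.exp (-(γ * x))

/-- The inverse of the limiting acceptance probability. -/
noncomputable def inverseRate (β γ x : ℝ) : ℝ := Real.exp (γ * (β - unusedDensity β γ x))

/-- The limiting time needed to accept a fraction `x` of the vertices. -/
noncomputable def timeAt (β γ x : ℝ) : ℝ := ∫ y in (0 : ℝ)..x, inverseRate β γ y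

theorem continuous_inverseRate (β γ : ℝ) : Continuous (inverseRate β γ) := by
  unfold inverseRate unusedDensity
  fun_prop

theorem hasDerivAt_timeAt (β γ x : ℝ) : HasDerivAt (timeAt β γ) (inverseRate β γ x) x :=
  intervalIntegral.integral_hasDerivAt_right
    ((continuous_inverseRate β γ).intervalIntegrable _ _)
    ((continuous_inverseRate β γ).stronglyMeasurableAtFilter _ _)
    (continuous_inverseRate β γ).continuousAt

theorem timeAt_zero (β γ : ℝ) : timeAt β γ 0 = 0 := by simp [timeAt]

section Estimates

variable {β γ : ℝ}

theorem unusedDensity_nonneg (hβ : 0 < β) (x : ℝ) : 0 ≤ unusedDensity β γ x := by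
  unfold unusedDensity
  positivity

theorem unusedDensity_le (hβ : 0 < β) (hγ : 0 < γ) {x : ℝ} (hx : 0 ≤ x) :
    unusedDensity β γ x ≤ β := by
  unfold unusedDensity
  have : Real.exp (-(γ * x)) ≤ 1 :=
    Real.exp_le_one_iff.2 (by have := mul_nonneg hγ.le hx; linarith)
  nlinarith

theorem one_le_inverseRate (hβ : 0 < β) (hγ : 0 < γ) {x : ℝ} (hx : 0 ≤ x) :
    1 ≤ inverseRate β γ x := by
  unfold inverseRate
  exact Real.one_le_exp (mul_nonneg hγ.le (sub_nonneg.2 (unusedDensity_le hβ hγ hx)))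

theorem inverseRate_le (hβ : 0 < β) (hγ : 0 < γ) (x : ℝ) :
    inverseRate β γ x ≤ Real.exp (γ * β) := by
  unfold inverseRate
  have := unusedDensity_nonneg (γ := γ) hβ x
  gcongr
  linarith

theorem abs_unusedDensity_step (hβ : 0 < β) (hγ : 0 < γ) {x h : ℝ} (hx : 0 ≤ x) (hh : 0 ≤ h)
    (hh1 : γ * h ≤ 1) :
    |unusedDensity β γ x - unusedDensity β γ (x + h) - γ * h * unusedDensity β γ x| ≤
      β * (γ * h) ^ 2 := by
  have h1 : unusedDensity β γ x - unusedDensity β γ (x + h) - γ * h * unusedDensity β γ x =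
      -(unusedDensity β γ x * (Real.exp (-(γ * h)) - 1 - -(γ * h))) := by
    unfold unusedDensity
    rw [mul_add, neg_add, Real.exp_add]
    ring
  have h0 : 0 ≤ γ * h := by positivity
  have h2 := Real.abs_exp_sub_one_sub_id_le (x := -(γ * h)) (by rwa [abs_neg, abs_of_nonneg h0])
  rw [neg_sq] at h2
  rw [h1, abs_neg, abs_mul, abs_of_nonneg (unusedDensity_nonneg hβ x)]
  exact mul_le_mul (unusedDensity_le hβ hγ hx) h2 (abs_nonneg _) hβ.le

theorem abs_timeAt_step (hβ : 0 < β) (hγ : 0 < γ) {x h : ℝ} (hx : 0 ≤ x) (hh : 0 ≤ h) :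
    |timeAt β γ (x + h) - timeAt β γ x - h * inverseRate β γ x| ≤
      Real.exp (γ * β) * (γ ^ 2 * β) * h ^ 2 := by
  have hi := fun a b => (continuous_inverseRate β γ).intervalIntegrable (μ := volume) a b
  have h1 : timeAt β γ (x + h) - timeAt β γ x - h * inverseRate β γ x =
      ∫ y in x..x + h, (inverseRate β γ y - inverseRate β γ x) := by
    rw [intervalIntegral.integral_sub (hi _ _) (by simp), intervalIntegral.integral_const, timeAt,
      timeAt, ← intervalIntegral.integral_add_adjacent_intervals (hi 0 x) (hi x (x + h)),
      smul_eq_mul]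
    ring
  rw [h1, ← Real.norm_eq_abs]
  refine (intervalIntegral.norm_integral_le_of_norm_le_const
    (C := Real.exp (γ * β) * (γ ^ 2 * β) * h) ?_).trans ?_
  · intro y hy
    rw [Set.uIoc_of_le (by linarith)] at hy
    have hy0 : 0 ≤ y := hx.trans hy.1.le
    have ha : ∀ y, γ * (β - unusedDensity β γ y) ≤ γ * β := fun y => by
      have := unusedDensity_nonneg (γ := γ) hβ y
      gcongr
      linarith
    rw [Real.norm_eq_abs]
    refine (abs_exp_sub_exp_le (ha y) (ha x)).trans ?_
    rw [mul_assoc]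
    refine mul_le_mul_of_nonneg_left ?_ (Real.exp_pos _).le
    have h3 := abs_exp_sub_exp_le (a := -(γ * y)) (b := -(γ * x)) (K := 0)
      (by have := mul_nonneg hγ.le hy0; linarith) (by have := mul_nonneg hγ.le hx; linarith)
    rw [Real.exp_zero, one_mul] at h3
    calc |γ * (β - unusedDensity β γ y) - γ * (β - unusedDensity β γ x)|
        = γ * β * |Real.exp (-(γ * y)) - Real.exp (-(γ * x))| := by
          rw [show γ * (β - unusedDensity β γ y) - γ * (β - unusedDensity β γ x) =
            -(γ * β * (Real.exp (-(γ * y)) - Real.exp (-(γ * x)))) by unfold unusedDensity; ring,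
            abs_neg, abs_mul, abs_of_nonneg (by positivity : 0 ≤ γ * β)]
      _ ≤ γ * β * |-(γ * y) - -(γ * x)| := by gcongr
      _ = γ ^ 2 * β * (y - x) := by
          rw [show -(γ * y) - -(γ * x) = -(γ * (y - x)) by ring, abs_neg,
            abs_of_nonneg (mul_nonneg hγ.le (by linarith [hy.1]))]
          ring
      _ ≤ γ ^ 2 * β * h := by
          gcongr
          linarith [hy.2]
  · rw [add_sub_cancel_left, abs_of_nonneg hh]
    apply le_of_eq
    ring

theorem timeAt_sub_nonneg (hβ : 0 < β) (hγ : 0 < γ) {x h : ℝ} (hh : 0 ≤ h) :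
    0 ≤ timeAt β γ (x + h) - timeAt β γ x ∧
      timeAt β γ (x + h) - timeAt β γ x ≤ Real.exp (γ * β) * h := by
  have hi := fun a b => (continuous_inverseRate β γ).intervalIntegrable (μ := volume) a b
  have h1 : timeAt β γ (x + h) - timeAt β γ x = ∫ y in x..x + h, inverseRate β γ y := by
    rw [timeAt, timeAt, ← intervalIntegral.integral_add_adjacent_intervals (hi 0 x) (hi x (x + h))]
    ring
  rw [h1]
  constructor
  · exact intervalIntegral.integral_nonneg (by linarith) fun y _ => (Real.exp_pos _).le
  · have := intervalIntegral.integral_mono_on (by linarith : x ≤ x + h) (hi _ _)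
      (g := fun _ => Real.exp (γ * β)) (by simp) fun y _ => inverseRate_le hβ hγ y
    rw [intervalIntegral.integral_const, smul_eq_mul] at this
    linarith

/-- With h = 1/N, (1-γh)^d is close to e^{-γhd}, and hd is β minus the density (M-d)h of unused
attributes, up to the rounding error h in M. Replacing that density by its fluid value costs the
error |z|. -/
theorem abs_acceptance_sub_le (hβ : 0 < β) (hγ : 0 < γ) {x h : ℝ} (hx : 0 ≤ x) (hh : 0 ≤ h)
    (hh1 : γ * h ≤ 1) {M d : ℕ}
    (hd : d ≤ M) (hM : M * h ≤ β) (hM' : β - h ≤ M * h) :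
    |(1 - γ * h) ^ d * inverseRate β γ x - 1| ≤ Real.exp (γ * β) * (γ ^ 2 * β + γ) *
      (|((M : ℝ) - d) * h - unusedDensity β γ x| + h) := by
  have h0 : 0 ≤ γ * h := by positivity
  have hd' : (d : ℝ) ≤ M := by exact_mod_cast hd
  set z := ((M : ℝ) - d) * h - unusedDensity β γ x with hz
  have hw := unusedDensity_le hβ hγ hx
  have e1 : |(1 - γ * h) ^ d - Real.exp (-(γ * h)) ^ d| ≤ γ ^ 2 * β * h := by
    have h2 := Real.abs_exp_sub_one_sub_id_le (x := -(γ * h))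
      (by rwa [abs_neg, abs_of_nonneg h0])
    refine (abs_pow_sub_pow_le _ _ _).trans ?_
    have h3 : max |1 - γ * h| |Real.exp (-(γ * h))| ^ (d - 1) ≤ 1 := by
      apply pow_le_one₀ (le_max_of_le_left (abs_nonneg _))
      apply max_le
      · rw [abs_le]; constructor <;> linarith
      · rw [abs_of_pos (Real.exp_pos _)]
        exact Real.exp_le_one_iff.2 (by linarith)
    have h4 : |1 - γ * h - Real.exp (-(γ * h))| ≤ (γ * h) ^ 2 := by
      rw [abs_sub_comm]
      convert h2 using 1
      · congr 1; ring
      · ring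
    calc _ ≤ (γ * h) ^ 2 * M * 1 := by gcongr
      _ = γ ^ 2 * (M * h) * h := by ring
      _ ≤ _ := by gcongr
  have e2 : |Real.exp (-(γ * h)) ^ d - Real.exp (-(γ * (β - unusedDensity β γ x)))| ≤
      γ * (|z| + h) := by
    rw [← Real.exp_nat_mul]
    refine (abs_exp_sub_exp_le (K := 0) ?_ ?_).trans ?_
    · have := mul_nonneg (Nat.cast_nonneg (α := ℝ) d) h0
      linarith
    · have := mul_nonneg hγ.le (sub_nonneg.2 hw)
      linarith
    · rw [Real.exp_zero, one_mul, show (d : ℝ) * -(γ * h) - -(γ * (β - unusedDensity β γ x)) =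
        γ * (z + (β - M * h)) by rw [hz]; ring, abs_mul, abs_of_pos hγ]
      have : |β - M * h| ≤ h := abs_le.2 ⟨by linarith, by linarith⟩
      have := abs_add_le z (β - M * h)
      gcongr
      linarith
  have e3 : (1 - γ * h) ^ d * inverseRate β γ x - 1 = inverseRate β γ x *
      ((1 - γ * h) ^ d - Real.exp (-(γ * (β - unusedDensity β γ x)))) := by
    rw [mul_sub, inverseRate, ← Real.exp_add]
    simp [mul_comm]
  rw [e3, abs_mul, mul_assoc, inverseRate, abs_of_pos (Real.exp_pos _)]
  refine mul_le_mul (inverseRate_le hβ hγ x) ?_ (abs_nonneg _) (Real.exp_pos _).le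
  refine (abs_sub_le _ (Real.exp (-(γ * h)) ^ d) _).trans ?_
  have : 0 ≤ γ ^ 2 * β * |z| := by positivity
  nlinarith

end Estimates

/-! ### The drift of the squared distance and the discrete Gronwall argument. -/

/-- Here y is the error in time, z the error in unused attributes, a the acceptance probability, δ
the increment of `timeAt` on acceptance, ζ the mean new attribute error and q its variance. Since δ
≈ hg and ag ≈ 1, the mean increment aδ - h of y is O(h(|z| + h)); the products 2|y||z| and 2|y|h are
absorbed by squares. -/
theorem drift_estimate {a y z h g K₁ K₂ K₃ K₄ E b δ ζ q : ℝ} (h0 : 0 ≤ h) (h1 : h ≤ 1)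
    (ha0 : 0 ≤ a) (ha1 : a ≤ 1) (hK₁ : 0 ≤ K₁) (hK₂ : 0 ≤ K₂) (hK₃ : 0 ≤ K₃)
    (hag : |a * g - 1| ≤ K₁ * (|z| + h)) (hδ0 : 0 ≤ δ) (hδ1 : δ ≤ E * h)
    (hδ : |δ - h * g| ≤ K₂ * h ^ 2) (hz : |z| ≤ b) (hζ : |ζ| ≤ |z| + K₃ * h ^ 2)
    (hq0 : 0 ≤ q) (hq : q ≤ K₄ * h ^ 2) {C : ℝ}
    (hC : 2 * K₁ + 2 * K₂ + 1 + E ^ 2 + 2 * b * K₃ + K₃ ^ 2 + K₄ ≤ C) :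
    (1 - a) * ((y - h) ^ 2 + z ^ 2) + a * ((y + δ - h) ^ 2 + (ζ ^ 2 + q)) ≤
      (1 + C * h) * (y ^ 2 + z ^ 2) + C * h ^ 2 := by
  have hb : 0 ≤ b := (abs_nonneg _).trans hz
  have hh : h ^ 3 ≤ h ^ 2 := pow_le_pow_of_le_one h0 h1 (by norm_num)
  have hh4 : h ^ 4 ≤ h ^ 2 := pow_le_pow_of_le_one h0 h1 (by norm_num)
  have hyz := two_mul_le_add_sq |y| |z|
  have hyh := two_mul_le_add_sq |y| h
  rw [sq_abs] at hyz hyh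
  rw [sq_abs] at hyz
  have e1 : |a * δ - h| ≤ K₂ * h ^ 2 + h * (K₁ * (|z| + h)) := by
    rw [show a * δ - h = a * (δ - h * g) + h * (a * g - 1) by ring]
    refine (abs_add_le _ _).trans ?_
    rw [abs_mul, abs_mul, abs_of_nonneg ha0, abs_of_nonneg h0]
    refine add_le_add ?_ (mul_le_mul_of_nonneg_left hag h0)
    exact (mul_le_of_le_one_left (abs_nonneg _) ha1).trans hδ
  have e2 : y * (a * δ - h) ≤ |y| * (K₂ * h ^ 2 + h * (K₁ * (|z| + h))) :=
    (le_abs_self _).trans (by rw [abs_mul]; gcongr)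
  have e3 : 2 * (|y| * (K₂ * h ^ 2 + h * (K₁ * (|z| + h)))) ≤
      (2 * K₁ + K₂) * h * (y ^ 2 + z ^ 2) + (K₁ + K₂) * h ^ 2 := by
    have f1 : K₁ * h * (2 * |y| * |z|) ≤ K₁ * h * (y ^ 2 + z ^ 2) := by gcongr
    have f2 : (K₁ + K₂) * h * (2 * |y| * h) ≤ (K₁ + K₂) * h * (y ^ 2 + h ^ 2) := by gcongr
    have f3 : (K₁ + K₂) * h ^ 3 ≤ (K₁ + K₂) * h ^ 2 := by gcongr
    have f4 : 0 ≤ (K₁ + K₂) * h * z ^ 2 := by positivity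
    linarith
  have e4 : a * δ ^ 2 ≤ E ^ 2 * h ^ 2 := by
    calc a * δ ^ 2 ≤ 1 * (E * h) ^ 2 := by gcongr
      _ = _ := by ring
  have e5 : ζ ^ 2 ≤ z ^ 2 + (2 * b * K₃ + K₃ ^ 2) * h ^ 2 := by
    calc ζ ^ 2 = |ζ| ^ 2 := (sq_abs _).symm
      _ ≤ (|z| + K₃ * h ^ 2) ^ 2 := by gcongr
      _ = z ^ 2 + 2 * |z| * K₃ * h ^ 2 + K₃ ^ 2 * h ^ 4 := by rw [add_sq, sq_abs]; ring
      _ ≤ z ^ 2 + 2 * b * K₃ * h ^ 2 + K₃ ^ 2 * h ^ 2 := by gcongr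
      _ = _ := by ring
  have hK₄ : 0 ≤ K₄ * h ^ 2 := hq0.trans hq
  have e6 : (1 - a) * z ^ 2 + a * (ζ ^ 2 + q) ≤
      z ^ 2 + (2 * b * K₃ + K₃ ^ 2 + K₄) * h ^ 2 := by
    have f1 : a * (ζ ^ 2 + q) ≤
        a * (z ^ 2 + (2 * b * K₃ + K₃ ^ 2) * h ^ 2 + K₄ * h ^ 2) := by gcongr
    have f2 : a * ((2 * b * K₃ + K₃ ^ 2) * h ^ 2 + K₄ * h ^ 2) ≤
        1 * ((2 * b * K₃ + K₃ ^ 2) * h ^ 2 + K₄ * h ^ 2) := by gcongr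
    linarith
  -- Expanding the squares in y leaves a cross term -2ahδ, which is dropped by its sign.
  have e7 : 0 ≤ a * h * δ := by positivity
  have e8 : (2 * K₁ + 2 * K₂ + 1 + E ^ 2 + 2 * b * K₃ + K₃ ^ 2 + K₄) * h ^ 2 ≤ C * h ^ 2 := by
    gcongr
  have e9 : (2 * K₁ + K₂) * h * (y ^ 2 + z ^ 2) ≤ C * h * (y ^ 2 + z ^ 2) := by
    have : 0 ≤ h * (y ^ 2 + z ^ 2) := by positivity
    rcases eq_or_lt_of_le h0 with rfl | hpos
    · simp
    · have : 0 ≤ K₄ := nonneg_of_mul_nonneg_left hK₄ (by positivity)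
      have : 2 * K₁ + K₂ ≤ C := by
        refine le_trans ?_ hC
        have : 0 ≤ 2 * b * K₃ + K₃ ^ 2 + E ^ 2 := by positivity
        linarith
      gcongr
  have e10 : 0 ≤ (K₁ + K₂) * h ^ 2 := by positivity
  linarith

/-- The squared distance of the state of the greedy algorithm from the fluid limit, where `x` is
the accepted fraction, `s` the processed fraction and `w` the density of unused attributes. -/
noncomputable def distSq (β γ x s w : ℝ) : ℝ :=
  (timeAt β γ x - s) ^ 2 + (w - unusedDensity β γ x) ^ 2

/-- The constant in the drift estimate. -/
noncomputable def driftConst (β γ : ℝ) : ℝ :=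
  2 * (Real.exp (γ * β) * (γ ^ 2 * β + γ)) + 2 * (Real.exp (γ * β) * (γ ^ 2 * β)) + 1 +
    Real.exp (γ * β) ^ 2 + 2 * β * (β * γ ^ 2) + (β * γ ^ 2) ^ 2 + β * γ

theorem distSq_drift {β γ : ℝ} (hβ : 0 < β) (hγ : 0 < γ) {h x : ℝ} (s : ℝ) (hx : 0 ≤ x)
    (hh : 0 ≤ h) (hh1 : h ≤ 1) (hγh : γ * h ≤ 1) {M d : ℕ} (hd : d ≤ M) (hM : M * h ≤ β)
    (hM' : β - h ≤ M * h) :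
    (1 - (1 - γ * h) ^ d) * distSq β γ x (s + h) (((M : ℝ) - d) * h) +
      (1 - γ * h) ^ d * binomialMean (M - d) (γ * h)
        (fun k => distSq β γ (x + h) (s + h) (((M : ℝ) - (d + k : ℕ)) * h)) ≤
      (1 + driftConst β γ * h) * distSq β γ x s (((M : ℝ) - d) * h) +
        driftConst β γ * h ^ 2 := by
  have hp0 : 0 ≤ γ * h := by positivity
  have hd' : (d : ℝ) ≤ M := by exact_mod_cast hd
  set w := ((M : ℝ) - d) * h with hw
  have hw0 : 0 ≤ w := mul_nonneg (sub_nonneg.2 hd') hh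
  have hwβ : w ≤ β := by
    have := mul_nonneg (Nat.cast_nonneg (α := ℝ) d) hh
    linarith
  set u := unusedDensity β γ x with hu
  have hu0 : 0 ≤ u := unusedDensity_nonneg hβ x
  have huβ : u ≤ β := unusedDensity_le hβ hγ hx
  set v := unusedDensity β γ (x + h) with hv
  -- Bias plus variance: on acceptance the density w of unused attributes has mean w - γhw and
  -- variance h²γw(1-γh).
  have hmean : binomialMean (M - d) (γ * h)
      (fun k => distSq β γ (x + h) (s + h) (((M : ℝ) - (d + k : ℕ)) * h)) =
      (timeAt β γ (x + h) - (s + h)) ^ 2 +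
        ((w - v - γ * h * w) ^ 2 + h ^ 2 * (γ * w * (1 - γ * h))) := by
    have : (fun k : ℕ => distSq β γ (x + h) (s + h) (((M : ℝ) - (d + k : ℕ)) * h)) =
        fun k : ℕ => ((timeAt β γ (x + h) - (s + h)) ^ 2 + (w - v) ^ 2) +
          (-2 * h * (w - v)) * k + h ^ 2 * (k : ℝ) ^ 2 := by
      funext k
      rw [distSq, hw, hv]
      push_cast
      ring
    rw [this, binomialMean_quadratic, Nat.cast_sub hd, hw]
    ring
  have hs := abs_unusedDensity_step hβ hγ hx hh hγh
  have h1γ : 0 ≤ 1 - γ * h := by linarith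
  have := drift_estimate (a := (1 - γ * h) ^ d) (y := timeAt β γ x - s) (z := w - u) (h := h)
    (g := inverseRate β γ x) (δ := timeAt β γ (x + h) - timeAt β γ x) (ζ := w - v - γ * h * w)
    (q := h ^ 2 * (γ * w * (1 - γ * h))) (b := β) (K₃ := β * γ ^ 2) (K₄ := β * γ)
    hh hh1 (pow_nonneg h1γ _) (pow_le_one₀ h1γ (by linarith)) (by positivity) (by positivity)
    (by positivity) (abs_acceptance_sub_le hβ hγ hx hh hγh hd hM hM')
    (timeAt_sub_nonneg hβ hγ hh).1 (timeAt_sub_nonneg hβ hγ hh).2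
    (abs_timeAt_step hβ hγ hx hh) (abs_le.2 ⟨by linarith, by linarith⟩) ?_ (by positivity) ?_
    (C := driftConst β γ) le_rfl
  · refine le_trans (le_of_eq ?_) this
    rw [hmean, distSq]
    ring
  · rw [show w - v - γ * h * w = (1 - γ * h) * (w - u) + (u - v - γ * h * u) by ring]
    refine (abs_add_le _ _).trans (add_le_add ?_ ?_)
    · rw [abs_mul, abs_of_nonneg h1γ]
      exact mul_le_of_le_one_left (abs_nonneg _) (by linarith)
    · exact hs.trans (le_of_eq (by ring))
  · calc h ^ 2 * (γ * w * (1 - γ * h)) ≤ h ^ 2 * (γ * β * 1) := by gcongr; linarith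
      _ = β * γ * h ^ 2 := by ring

/-- The mean square of the time error at the end of the greedy algorithm. -/
theorem sum_acceptCount_timeAt_le {β γ : ℝ} (hβ : 0 < β) (hγ : 0 < γ) {N M : ℕ} (hN : 0 < N)
    (hγN : γ ≤ N) (hM : M = ⌊β * N⌋₊) {l : List (Fin N)} (hl : l.Nodup) (hlen : l.length = N) :
    ∑ ρ : Fin N → Finset (Fin M), (∏ u, rowWeight (γ / N) (ρ u)) *
        (timeAt β γ ((acceptCount ρ l ∅ : ℕ) / N) - 1) ^ 2 ≤
      Real.exp (driftConst β γ) * (1 / (N : ℝ) ^ 2 + driftConst β γ / N) := by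
  have hN' : (0 : ℝ) < N := by exact_mod_cast hN
  set h : ℝ := (N : ℝ)⁻¹ with hh
  set C := driftConst β γ with hC
  have hC0 : 0 ≤ C := by rw [hC, driftConst]; positivity
  have h0 : 0 < h := by positivity
  have h1 : h ≤ 1 := inv_le_one_of_one_le₀ (by exact_mod_cast hN)
  have hNh : (N : ℝ) * h = 1 := mul_inv_cancel₀ hN'.ne'
  have hγh : γ * h ≤ 1 := by
    rw [← hNh]
    gcongr
  have hMh : (M : ℝ) * h ≤ β := by
    have : (M : ℝ) ≤ β * N := by rw [hM]; exact Nat.floor_le (by positivity)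
    calc (M : ℝ) * h ≤ β * N * h := by gcongr
      _ = β := by rw [mul_assoc, hNh, mul_one]
  have hMh' : β - h ≤ M * h := by
    have : β * N < M + 1 := by rw [hM]; exact Nat.lt_floor_add_one _
    have : β * N * h ≤ (M + 1) * h := by gcongr
    rw [mul_assoc, hNh] at this
    linarith
  -- The index j counts the vertices still to be processed, so the processed fraction is 1 - jh. The
  -- factor (1 + Ch)^j and the term jCh² absorb the drift of the remaining j steps.
  have key := sum_acceptCount_le (α := Fin N) (β := Fin M) (p := γ * h) (by positivity) hγh
    (fun e => (timeAt β γ (e * h) - 1) ^ 2)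
    (fun j e d => (1 + C * h) ^ j *
      (distSq β γ (e * h) (1 - j * h) (((M : ℝ) - d) * h) + j * (C * h ^ 2)))
    ?_ ?_ hl 0 ∅
  · simp only [zero_add, Finset.card_empty, hlen, Nat.cast_zero, zero_mul, hNh, sub_self,
      sub_zero] at key
    -- The initial error comes only from rounding βN down to M.
    have hd0 : distSq β γ 0 0 (M * h) ≤ h ^ 2 := by
      rw [distSq, timeAt_zero, unusedDensity]
      simp only [sub_self, mul_zero, neg_zero, Real.exp_zero, mul_one]
      rw [zero_pow two_ne_zero, zero_add, sq_le_sq, abs_of_pos h0]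
      exact abs_le.2 ⟨by linarith, by linarith⟩
    have hexp : (1 + C * h) ^ N ≤ Real.exp C := by
      calc (1 + C * h) ^ N ≤ Real.exp (C * h) ^ N := by
            gcongr
            linarith [Real.add_one_le_exp (C * h)]
        _ = Real.exp C := by
            rw [← Real.exp_nat_mul, mul_left_comm, hNh, mul_one]
    calc _ ≤ _ := key
      _ ≤ Real.exp C * (h ^ 2 + N * (C * h ^ 2)) := by
          have : 0 ≤ distSq β γ 0 0 (M * h) := by unfold distSq; positivity
          gcongr
      _ = _ := by
          rw [hh]
          field_simp
  · intro e d _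
    simp only [pow_zero, one_mul, Nat.cast_zero, zero_mul, sub_zero, add_zero]
    rw [distSq]
    exact le_add_of_nonneg_right (sq_nonneg _)
  · intro j e d hd
    rw [Fintype.card_fin] at hd ⊢
    have hstep := distSq_drift hβ hγ (x := e * h) (1 - (j + 1) * h) (by positivity) h0.le h1 hγh hd
      hMh hMh'
    have hmean : binomialMean (M - d) (γ * h) (fun k => (1 + C * h) ^ j *
        (distSq β γ ((e + 1 : ℕ) * h) (1 - j * h) (((M : ℝ) - (d + k : ℕ)) * h) +
          j * (C * h ^ 2))) = (1 + C * h) ^ j * (binomialMean (M - d) (γ * h)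
        (fun k => distSq β γ (e * h + h) (1 - j * h) (((M : ℝ) - (d + k : ℕ)) * h)) +
          j * (C * h ^ 2)) := by
      conv_rhs => rw [← binomialMean_const (M - d) (γ * h) (j * (C * h ^ 2))]
      unfold binomialMean
      rw [← Finset.sum_add_distrib, Finset.mul_sum]
      refine Finset.sum_congr rfl fun k _ => ?_
      push_cast
      ring_nf
    rw [hmean, Nat.cast_succ]
    rw [show (1 : ℝ) - (j + 1) * h + h = 1 - j * h by ring, ← hC] at hstep
    have hpow : 0 ≤ (1 + C * h) ^ j := by positivity
    have hCh : 0 ≤ C * h := by positivity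
    have hj : 0 ≤ ((j : ℝ) + 1) * (C * h ^ 2) := by positivity
    calc _ = (1 + C * h) ^ j * ((1 - (1 - γ * h) ^ d) * distSq β γ (e * h) (1 - j * h)
            (((M : ℝ) - d) * h) + (1 - γ * h) ^ d * binomialMean (M - d) (γ * h)
            (fun k => distSq β γ (e * h + h) (1 - j * h) (((M : ℝ) - (d + k : ℕ)) * h)) +
              j * (C * h ^ 2)) := by ring
      _ ≤ (1 + C * h) ^ j * ((1 + C * h) * distSq β γ (e * h) (1 - (j + 1) * h)
            (((M : ℝ) - d) * h) + C * h ^ 2 + j * (C * h ^ 2)) := by gcongr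
      _ ≤ (1 + C * h) ^ j * ((1 + C * h) * distSq β γ (e * h) (1 - (j + 1) * h)
            (((M : ℝ) - d) * h) + (1 + C * h) * ((j + 1) * (C * h ^ 2))) := by
          have := mul_nonneg hCh hj
          refine mul_le_mul_of_nonneg_left ?_ hpow
          linarith
      _ = _ := by ring

/-! ### The integral equations and the zero of their solutions. -/

/-- The derivative `inverseRate` is at least 1 on [0, ∞). This turns errors in time into errors in
the accepted fraction, and makes the root of `timeAt` = 1 unique. -/
theorem abs_sub_le_abs_timeAt_sub {β γ : ℝ} (hβ : 0 < β) (hγ : 0 < γ) {x y : ℝ} (hx : 0 ≤ x)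
    (hy : 0 ≤ y) : |x - y| ≤ |timeAt β γ x - timeAt β γ y| := by
  wlog h : y ≤ x generalizing x y
  · rw [abs_sub_comm, abs_sub_comm (timeAt β γ x)]
    exact this hy hx (le_of_not_ge h)
  have hi := fun a b => (continuous_inverseRate β γ).intervalIntegrable (μ := volume) a b
  have h1 : timeAt β γ x - timeAt β γ y = ∫ t in y..x, inverseRate β γ t := by
    rw [timeAt, timeAt, ← intervalIntegral.integral_add_adjacent_intervals (hi 0 y) (hi y x)]
    ring
  have h2 := intervalIntegral.integral_mono_on h (f := fun _ => (1 : ℝ)) (by simp) (hi y x)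
    fun t ht => one_le_inverseRate hβ hγ (hy.trans ht.1)
  rw [intervalIntegral.integral_const, smul_eq_mul, mul_one, ← h1] at h2
  rw [abs_of_nonneg (sub_nonneg.2 h)]
  exact h2.trans (le_abs_self _)

theorem exists_timeAt_eq_one {β γ : ℝ} (hβ : 0 < β) (hγ : 0 < γ) :
    ∃ s ∈ Set.Icc (0 : ℝ) 1, timeAt β γ s = 1 := by
  have hc : ContinuousOn (timeAt β γ) (Set.Icc 0 1) := fun x _ =>
    (hasDerivAt_timeAt β γ x).continuousAt.continuousWithinAt
  have h1 : 1 ≤ timeAt β γ 1 := by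
    have h := abs_sub_le_abs_timeAt_sub hβ hγ zero_le_one le_rfl
    have h2 := (timeAt_sub_nonneg hβ hγ (x := 0) zero_le_one).1
    rw [zero_add] at h2
    rw [abs_of_nonneg h2, timeAt_zero] at h
    simpa using h
  exact intermediate_value_Icc zero_le_one hc ⟨by rw [timeAt_zero]; exact zero_le_one, h1⟩

theorem hasDerivAt_unusedDensity (β γ x : ℝ) :
    HasDerivAt (unusedDensity β γ) (-(γ * unusedDensity β γ x)) x := by
  have h : HasDerivAt (fun x => -(γ * x)) (-γ) x := by
    exact HasDerivAt.congr_deriv ((hasDerivAt_id x).const_mul γ).neg (by rw [mul_one])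
  refine HasDerivAt.congr_deriv (h.exp.const_mul β) ?_
  unfold unusedDensity
  ring

theorem hasDerivAt_inverseRate (β γ x : ℝ) :
    HasDerivAt (inverseRate β γ) (γ ^ 2 * unusedDensity β γ x * inverseRate β γ x) x := by
  refine HasDerivAt.congr_deriv ((((hasDerivAt_unusedDensity β γ x).const_sub β).const_mul γ).exp) ?_
  simp only [inverseRate, neg_neg]
  ring

theorem isFluidLimit_explicit (β γ : ℝ) : IsFluidLimit β γ
    (fun s => (1 - timeAt β γ s) / inverseRate β γ s) (unusedDensity β γ) := by
  have hpos : ∀ s, inverseRate β γ s ≠ 0 := fun s => (Real.exp_pos _).ne'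
  have hu : ∀ s, HasDerivAt (fun s => (1 - timeAt β γ s) / inverseRate β γ s)
      (-1 - γ ^ 2 * ((1 - timeAt β γ s) / inverseRate β γ s) * unusedDensity β γ s) s := by
    intro s
    refine HasDerivAt.congr_deriv (((hasDerivAt_timeAt β γ s).const_sub 1).div
      (hasDerivAt_inverseRate β γ s) (hpos s)) ?_
    have := hpos s
    field_simp
  have hcu : Continuous fun s => (1 - timeAt β γ s) / inverseRate β γ s :=
    continuous_iff_continuousAt.2 fun s => (hu s).continuousAt
  have hcw : Continuous (unusedDensity β γ) :=
    continuous_iff_continuousAt.2 fun s => (hasDerivAt_unusedDensity β γ s).continuousAt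
  have hcuw : Continuous fun y =>
      γ ^ 2 * ((1 - timeAt β γ y) / inverseRate β γ y) * unusedDensity β γ y := by
    fun_prop
  have hcw' : Continuous fun y => γ * unusedDensity β γ y := by fun_prop
  refine ⟨hcuw.intervalIntegrable _ _, hcw'.intervalIntegrable _ _, fun s _ => ?_, fun s _ => ?_⟩
  · rw [intervalIntegral.integral_eq_sub_of_hasDerivAt
      (f := fun s => -((1 - timeAt β γ s) / inverseRate β γ s) - s) (fun y _ => ?_)
      (hcuw.intervalIntegrable _ _)]
    · simp [timeAt_zero, inverseRate, unusedDensity]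
      ring
    · refine HasDerivAt.congr_deriv ((hu y).neg.sub (hasDerivAt_id y)) ?_
      ring
  · rw [intervalIntegral.integral_eq_sub_of_hasDerivAt
      (f := fun s => -unusedDensity β γ s) (fun y _ => ?_) (hcw'.intervalIntegrable _ _)]
    · simp [unusedDensity]
    · refine HasDerivAt.congr_deriv ((hasDerivAt_unusedDensity β γ y).neg) ?_
      ring

theorem eq_of_hasDerivAt_zero {f : ℝ → ℝ} (hc : ContinuousOn f (Set.Icc 0 1))
    (hd : ∀ x ∈ Set.Ioo (0 : ℝ) 1, HasDerivAt f 0 x) {s : ℝ} (hs : s ∈ Set.Icc (0 : ℝ) 1) :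
    f s = f 0 := by
  rcases eq_or_lt_of_le hs.1 with rfl | h
  · rfl
  · obtain ⟨c, -, h2⟩ := exists_hasDerivAt_eq_slope f (fun _ => 0) h
      (hc.mono (Set.Icc_subset_Icc le_rfl hs.2)) fun x hx => hd x ⟨hx.1, hx.2.trans_le hs.2⟩
    have h3 : s - 0 ≠ 0 := by rw [sub_zero]; exact h.ne'
    rw [eq_div_iff h3, zero_mul] at h2
    linarith

theorem continuousOn_primitive_unit {f : ℝ → ℝ} (hf : IntervalIntegrable f volume 0 1) :
    ContinuousOn (fun s => ∫ y in (0 : ℝ)..s, f y) (Set.Icc 0 1) := by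
  have := intervalIntegral.continuousOn_primitive_interval (μ := volume) (f := f) (a := 0) (b := 1)
    (by rwa [Set.uIcc_of_le zero_le_one, ← intervalIntegrable_iff_integrableOn_Icc_of_le
      zero_le_one])
  rwa [Set.uIcc_of_le zero_le_one] at this

theorem hasDerivAt_primitive_unit {f : ℝ → ℝ} (hf : IntervalIntegrable f volume 0 1)
    (hc : ContinuousOn f (Set.Icc 0 1)) {s : ℝ} (hs : s ∈ Set.Ioo (0 : ℝ) 1) :
    HasDerivAt (fun s => ∫ y in (0 : ℝ)..s, f y) (f s) s := by
  have hc' : ContinuousOn f (Set.Ioo 0 1) := hc.mono Set.Ioo_subset_Icc_self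
  refine intervalIntegral.integral_hasDerivAt_right (hf.mono_set ?_)
    (hc'.stronglyMeasurableAtFilter isOpen_Ioo s hs) (hc'.continuousAt (isOpen_Ioo.mem_nhds hs))
  rw [Set.uIcc_of_le zero_le_one, Set.uIcc_of_le hs.1.le]
  exact Set.Icc_subset_Icc le_rfl hs.2.le

/-- The second equation makes w e^{γx} constant, so w is `unusedDensity`. Then `inverseRate` is an
integrating factor for u' = -1 - γ²uw: the derivative of u · `inverseRate` is -`inverseRate`. -/
theorem IsFluidLimit.mul_inverseRate {β γ : ℝ} {u w : ℝ → ℝ} (h : IsFluidLimit β γ u w) {s : ℝ}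
    (hs : s ∈ Set.Icc (0 : ℝ) 1) : u s * inverseRate β γ s + timeAt β γ s = 1 := by
  -- Bootstrapping: integrability makes the primitives, hence u and w, continuous, and continuity of
  -- the integrands makes u and w differentiable inside the interval.
  have hcw : ContinuousOn w (Set.Icc 0 1) :=
    (continuousOn_const.sub (continuousOn_primitive_unit h.integrable_w)).congr h.eq_w
  have hcu : ContinuousOn u (Set.Icc 0 1) :=
    ((continuousOn_const.sub continuousOn_id).sub
      (continuousOn_primitive_unit h.integrable_uw)).congr h.eq_u
  have hdw : ∀ x ∈ Set.Ioo (0 : ℝ) 1, HasDerivAt w (-(γ * w x)) x := by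
    intro x hx
    refine (((hasDerivAt_primitive_unit h.integrable_w (by fun_prop) hx).const_sub
      β)).congr_of_eventuallyEq ?_
    filter_upwards [isOpen_Ioo.mem_nhds hx] with y hy
    exact h.eq_w y (Set.Ioo_subset_Icc_self hy)
  have hdu : ∀ x ∈ Set.Ioo (0 : ℝ) 1, HasDerivAt u (-1 - γ ^ 2 * u x * w x) x := by
    intro x hx
    refine ((((hasDerivAt_id x).const_sub 1).sub
      (hasDerivAt_primitive_unit h.integrable_uw (by fun_prop) hx))).congr_of_eventuallyEq ?_
    filter_upwards [isOpen_Ioo.mem_nhds hx] with y hy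
    exact h.eq_u y (Set.Ioo_subset_Icc_self hy)
  have hw : ∀ x ∈ Set.Icc (0 : ℝ) 1, w x = unusedDensity β γ x := by
    intro x hx
    have h1 := eq_of_hasDerivAt_zero (f := fun x => w x * Real.exp (γ * x))
      (hcw.mul (by fun_prop)) (fun y hy => ?_) hx
    · have h0 := h.eq_w 0 ⟨le_rfl, zero_le_one⟩
      simp only [intervalIntegral.integral_same, sub_zero] at h0
      simp only [mul_zero, Real.exp_zero, mul_one, h0] at h1
      rw [unusedDensity, ← h1, mul_assoc, ← Real.exp_add]
      simp
    · have he : HasDerivAt (fun x => Real.exp (γ * x)) (Real.exp (γ * y) * γ) y := by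
        exact HasDerivAt.congr_deriv ((hasDerivAt_id y).const_mul γ).exp (by simp)
      refine HasDerivAt.congr_deriv ((hdw y hy).mul he) ?_
      ring
  have hcont : ContinuousOn (fun x => u x * inverseRate β γ x + timeAt β γ x) (Set.Icc 0 1) :=
    (hcu.mul (continuous_inverseRate β γ).continuousOn).add fun x _ =>
      (hasDerivAt_timeAt β γ x).continuousAt.continuousWithinAt
  have h1 := eq_of_hasDerivAt_zero hcont (fun x hx => ?_) hs
  · have h0 := h.eq_u 0 ⟨le_rfl, zero_le_one⟩
    simp only [intervalIntegral.integral_same, sub_zero] at h0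
    simpa [h0, timeAt_zero, inverseRate, unusedDensity] using h1
  · refine HasDerivAt.congr_deriv (((hdu x hx).mul (hasDerivAt_inverseRate β γ x)).add
      (hasDerivAt_timeAt β γ x)) ?_
    rw [hw x (Set.Ioo_subset_Icc_self hx)]
    ring

/-! ### Concentration for the random incidence relation and passage to the hitting time. -/

/-- An incidence relation as a family of attribute sets. -/
noncomputable def attributesEquiv (N m : ℕ) :
    Set (Fin N × Fin m) ≃ (Fin N → Finset (Fin m)) where
  toFun := attributes
  invFun ρ := {x | x.2 ∈ ρ x.1}
  left_inv A := by
    ext ⟨u, a⟩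
    simp [mem_attributes]
  right_inv ρ := by
    funext u
    ext a
    simp [mem_attributes]

/-- Grouping the Bernoulli factors by vertex shows that the attribute sets are independent rows. The
condition γ ≤ N makes the cap on the probability inactive. -/
theorem incidenceLaw_apply {N : ℕ} {β γ : ℝ} (hγ : 0 < γ) (hN : 0 < N) (hγN : γ ≤ N)
    (A : Set (Fin N × Fin ⌊β * N⌋₊)) :
    incidenceLaw N β γ A = ENNReal.ofReal (∏ u, rowWeight (γ / N) (attributes A u)) := by
  classical
  have hN' : (0 : ℝ) < N := by exact_mod_cast hN
  have hp : (connectProb N γ : ℝ) = γ / N := by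
    rw [connectProb, Set.projIcc_of_mem zero_le_one
      ⟨by positivity, (div_le_one hN').2 hγN⟩]
  have h1 : incidenceLaw N β γ A =
      (setBernoulli (Set.univ : Set (Fin N × Fin ⌊β * N⌋₊)) (connectProb N γ)) {A} := rfl
  have h2 := setBernoulli_real_singleton (connectProb N γ) (Set.subset_univ A) Set.finite_univ
  rw [h1, ← ENNReal.ofReal_toReal (measure_ne_top _ {A}), ← measureReal_def, h2, hp]
  congr 1
  have hcard : A.ncard = ∑ u, (attributes A u).card := by
    rw [← Finset.card_sigma, Set.ncard_eq_toFinset_card']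
    refine Finset.card_nbij' (fun x => ⟨x.1, x.2⟩) (fun x => (x.1, x.2)) ?_ ?_ ?_ ?_ <;>
      simp [Set.MapsTo, Set.LeftInvOn, mem_attributes]
  have hcard' : (Set.univ \ A).ncard =
      ∑ u, (Fintype.card (Fin ⌊β * N⌋₊) - (attributes A u).card) := by
    have h3 := Set.ncard_sdiff_add_ncard_of_subset (Set.subset_univ A)
    rw [Set.ncard_univ, Nat.card_eq_fintype_card, Fintype.card_prod] at h3
    have h4 : ∑ u, (Fintype.card (Fin ⌊β * N⌋₊) - (attributes A u).card) +
        ∑ u, (attributes A u).card = Fintype.card (Fin N) * Fintype.card (Fin ⌊β * N⌋₊) := by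
      rw [← Finset.sum_add_distrib, Finset.sum_congr rfl
        (g := fun _ => Fintype.card (Fin ⌊β * N⌋₊)) fun u _ =>
          Nat.sub_add_cancel (Finset.card_le_univ _)]
      simp
    omega
  simp only [rowWeight]
  rw [Finset.prod_mul_distrib, Finset.prod_pow_eq_pow_sum, Finset.prod_pow_eq_pow_sum, hcard,
    hcard']

theorem tsum_incidenceLaw_mul {N : ℕ} {β γ : ℝ} (hγ : 0 < γ) (hN : 0 < N) (hγN : γ ≤ N)
    {f : (Fin N → Finset (Fin ⌊β * N⌋₊)) → ℝ} (hf : ∀ ρ, 0 ≤ f ρ) :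
    ∑' A, incidenceLaw N β γ A * ENNReal.ofReal (f (attributes A)) =
      ENNReal.ofReal (∑ ρ, (∏ u, rowWeight (γ / N) (ρ u)) * f ρ) := by
  have hN' : (0 : ℝ) < N := by exact_mod_cast hN
  have hw : ∀ ρ : Fin N → Finset (Fin ⌊β * N⌋₊), 0 ≤ ∏ u, rowWeight (γ / N) (ρ u) := fun ρ =>
    Finset.prod_nonneg fun u _ => rowWeight_nonneg (by positivity) ((div_le_one hN').2 hγN) _
  rw [ENNReal.ofReal_sum_of_nonneg fun ρ _ => mul_nonneg (hw ρ) (hf ρ),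
    ← tsum_fintype (L := .unconditional _), ← (attributesEquiv N ⌊β * N⌋₊).tsum_eq]
  refine tsum_congr fun A => ?_
  rw [incidenceLaw_apply hγ hN hγN, ENNReal.ofReal_mul (hw _)]
  rfl

/-- The error in the concentration bound. -/
noncomputable def tailBound (β γ δ : ℝ) (N : ℕ) : ℝ :=
  Real.exp (driftConst β γ) * (1 / (N : ℝ) ^ 2 + driftConst β γ / N) / δ ^ 2

theorem tendsto_tailBound (β γ δ : ℝ) : Tendsto (tailBound β γ δ) atTop (𝓝 0) := by
  have h1 : Tendsto (fun N : ℕ => 1 / (N : ℝ) ^ 2) atTop (𝓝 0) :=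
    (tendsto_pow_atTop two_ne_zero).comp tendsto_natCast_atTop_atTop |>.const_div_atTop 1
  have h2 : Tendsto (fun N : ℕ => driftConst β γ / N) atTop (𝓝 0) :=
    tendsto_natCast_atTop_atTop.const_div_atTop _
  have := ((h1.add h2).const_mul (Real.exp (driftConst β γ))).div_const (δ ^ 2)
  simp only [add_zero, mul_zero, zero_div] at this
  exact this

/-- The concentration of the greedy algorithm in a fixed order. -/
theorem tsum_incidenceLaw_acceptCount_le {N : ℕ} {β γ δ s : ℝ} (hβ : 0 < β) (hγ : 0 < γ)
    (hN : 0 < N) (hγN : γ ≤ N) (hδ : 0 < δ) (hs : 0 ≤ s) (hs1 : timeAt β γ s = 1)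
    {l : List (Fin N)} (hl : l.Nodup) (hlen : l.length = N) {B : Set ℕ}
    (hB : ∀ e ∈ B, δ ≤ |(e : ℝ) / N - s|) :
    ∑' A, incidenceLaw N β γ A * B.indicator 1 (acceptCount (attributes A) l ∅) ≤
      ENNReal.ofReal (tailBound β γ δ N) := by
  -- Chebyshev's inequality, with the deviation of e/N from s dominated by the error in time.
  have hpt : ∀ e : ℕ, B.indicator (1 : ℕ → ℝ≥0∞) e ≤
      ENNReal.ofReal ((timeAt β γ (e / N) - 1) ^ 2 / δ ^ 2) := by
    intro e
    by_cases he : e ∈ B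
    · rw [Set.indicator_of_mem he, Pi.one_apply, ← ENNReal.ofReal_one]
      apply ENNReal.ofReal_le_ofReal
      rw [le_div_iff₀ (by positivity), one_mul, sq_le_sq, abs_of_pos hδ]
      refine (hB e he).trans ?_
      rw [← hs1]
      exact abs_sub_le_abs_timeAt_sub hβ hγ (by positivity) hs
    · simp [Set.indicator_of_notMem he]
  refine (ENNReal.tsum_le_tsum fun A => mul_le_mul_right (hpt _) _).trans ?_
  rw [tsum_incidenceLaw_mul (f := fun ρ => (timeAt β γ ((acceptCount ρ l ∅ : ℕ) / N) - 1) ^ 2 /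
    δ ^ 2) hγ hN hγN fun ρ => by positivity]
  apply ENNReal.ofReal_le_ofReal
  simp_rw [mul_div_assoc']
  rw [← Finset.sum_div, tailBound]
  gcongr
  exact sum_acceptCount_timeAt_le hβ hγ hN hγN rfl hl hlen

/-- An order of all vertices matters only through the order it induces on the intersection graph;
the isolated vertices always add `nIso c k` to the count. -/
theorem hittingTimeLaw_le {β γ c : ℝ} {k : ℕ} {B : Set ℕ} {b : ℝ≥0∞}
    (hb : ∀ l : List (Fin (nRIG β γ c k)), l.Nodup → l.length = nRIG β γ c k →
      ∑' A, incidenceLaw (nRIG β γ c k) β γ A *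
        B.indicator 1 (nIso c k + acceptCount (attributes A) l ∅) ≤ b) :
    (hittingTimeLaw β γ c k).toMeasure B ≤ b := by
  classical
  rw [hittingTimeLaw, PMF.toMeasure_bind_apply _ _ _ MeasurableSet.of_discrete]
  have hcard : Fintype.card (Fin (nRIG β γ c k) ⊕ Fin (nIso c k)) = numVertices β γ c k := by
    simp [numVertices]
  simp_rw [toMeasure_trajectory_map_hittingTime _ hcard.le]
  simp_rw [countProb_eq_orderAvg _ B (R := Finset.univ) (Finset.card_univ.trans hcard)
    (Finset.Subset.refl _) (Finset.card_univ.trans hcard).le]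
  rw [tsum_fintype, orderAvg_sum]
  refine orderAvg_le (Finset.card_univ.trans hcard) fun l hl hm => ?_
  have hm' : ∀ v, v ∈ l := fun v => (hm v).2 (Finset.mem_univ v)
  have hr : (l.filterMap Sum.getRight?).length = nIso c k := by
    rw [length_eq_card_of_nodup (nodup_filterMap_getRight hl), Fintype.card_fin]
    intro a
    rw [List.mem_filterMap]
    exact ⟨Sum.inr a, hm' _, rfl⟩
  have hl' : (l.filterMap Sum.getLeft?).length = nRIG β γ c k := by
    rw [length_eq_card_of_nodup (nodup_filterMap_getLeft hl), Fintype.card_fin]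
    intro a
    rw [List.mem_filterMap]
    exact ⟨Sum.inl a, hm' _, rfl⟩
  refine le_trans (le_of_eq ?_) (hb _ (nodup_filterMap_getLeft hl) hl')
  rw [tsum_fintype]
  refine Finset.sum_congr rfl fun A _ => ?_
  rw [add_zero, greedyCount_sum_bot A hl (D := ∅) (by simp) (by simp), hr]

/-! ### Asymptotics of the sizes and the conclusion. -/

section Parameters

variable {β γ c : ℝ}

theorem sigma_pos (hβ : 0 < β) (hγ : 0 < γ) (hc : 0 < c) : 0 < sigma β γ c := by
  have h1 : Real.exp (-c) < 1 := Real.exp_lt_one_iff.mpr (by linarith)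
  have h2 : Real.exp (-γ) < 1 := Real.exp_lt_one_iff.mpr (by linarith)
  have h3 : xi0 β γ < 1 := by
    have : 0 < β * γ * (1 - Real.exp (-γ)) := mul_pos (mul_pos hβ hγ) (by linarith)
    exact Real.exp_lt_one_iff.mpr (by linarith)
  exact div_pos (by linarith) (by linarith)

theorem tendsto_nRIG_div (hσ : 0 < sigma β γ c) :
    Tendsto (fun k : ℕ => (nRIG β γ c k : ℝ) / k) atTop (𝓝 (sigma β γ c)) :=
  (tendsto_nat_floor_mul_div_atTop hσ.le).comp tendsto_natCast_atTop_atTop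

theorem tendsto_nIso_div : Tendsto (fun k : ℕ => (nIso c k : ℝ) / k) atTop (𝓝 (Real.exp (-c))) :=
  (tendsto_nat_floor_mul_div_atTop (Real.exp_pos _).le).comp tendsto_natCast_atTop_atTop

theorem tendsto_nRIG (hσ : 0 < sigma β γ c) : Tendsto (nRIG β γ c) atTop atTop :=
  tendsto_nat_floor_atTop.comp (tendsto_natCast_atTop_atTop.const_mul_atTop hσ)

theorem tendsto_phi (hσ : 0 < sigma β γ c) (s : ℝ) :
    Tendsto (fun k : ℕ => ((nIso c k : ℝ) + nRIG β γ c k * s) / numVertices β γ c k) atTop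
      (𝓝 (phi β γ c s)) := by
  have h1 := (tendsto_nIso_div (c := c)).add ((tendsto_nRIG_div hσ).mul_const s)
  have h2 := (tendsto_nIso_div (c := c)).add (tendsto_nRIG_div hσ)
  have hne : Real.exp (-c) + sigma β γ c ≠ 0 := (add_pos (Real.exp_pos _) hσ).ne'
  refine (h1.div h2 hne).congr' ?_
  filter_upwards [eventually_gt_atTop 0] with k hk
  have hk' : (k : ℝ) ≠ 0 := by exact_mod_cast hk.ne'
  rw [Pi.div_apply, numVertices, Nat.cast_add, div_mul_eq_mul_div, ← add_div, ← add_div,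
    div_div_div_cancel_right₀ hk', add_comm (nRIG β γ c k : ℝ)]

end Parameters

theorem tendsto_hittingTimeLaw {β γ c : ℝ} (hβ : 0 < β) (hγ : 0 < γ) (hσ : 0 < sigma β γ c)
    {s : ℝ} (hs : 0 ≤ s) (hs1 : timeAt β γ s = 1) {ε : ℝ} (hε : 0 < ε) :
    Tendsto (fun k : ℕ => (hittingTimeLaw β γ c k).toMeasure
      {t : ℕ | ε ≤ |(t : ℝ) / (numVertices β γ c k : ℝ) - phi β γ c s|}) atTop (𝓝 0) := by
  -- Half of ε pays for the random fluctuation, the other half for the deterministic convergence of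
  -- the predicted ratio to φ.
  have hlim : Tendsto (fun k : ℕ => ENNReal.ofReal (tailBound β γ (ε / 2) (nRIG β γ c k))) atTop
      (𝓝 0) := by
    rw [← ENNReal.ofReal_zero]
    exact ENNReal.tendsto_ofReal ((tendsto_tailBound β γ (ε / 2)).comp (tendsto_nRIG hσ))
  refine tendsto_of_tendsto_of_tendsto_of_le_of_le' tendsto_const_nhds hlim
    (Eventually.of_forall fun _ => zero_le) ?_
  filter_upwards [(tendsto_nRIG hσ).eventually_gt_atTop 0,
    (tendsto_natCast_atTop_atTop.comp (tendsto_nRIG hσ)).eventually_ge_atTop γ,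
    (tendsto_phi hσ s).eventually (Metric.ball_mem_nhds _ (half_pos hε))] with k hN hγN hφ
  rw [Real.dist_eq] at hφ
  refine hittingTimeLaw_le fun l hl hlen => ?_
  refine le_trans (le_of_eq ?_) (tsum_incidenceLaw_acceptCount_le hβ hγ hN hγN (half_pos hε) hs hs1
    hl hlen (B := {e : ℕ | ε ≤ |((nIso c k + e : ℕ) : ℝ) / numVertices β γ c k - phi β γ c s|}) ?_)
  · rfl
  · intro e he
    rw [Set.mem_ofPred_eq] at he
    have hN' : (0 : ℝ) < nRIG β γ c k := by exact_mod_cast hN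
    have hn : (nRIG β γ c k : ℝ) ≤ numVertices β γ c k := by
      exact_mod_cast Nat.le_add_right _ _
    have hn0 : (0 : ℝ) < numVertices β γ c k := hN'.trans_le hn
    have h1 : |((nIso c k + e : ℕ) : ℝ) / numVertices β γ c k -
        ((nIso c k : ℝ) + nRIG β γ c k * s) / numVertices β γ c k| ≤
        |(e : ℝ) / nRIG β γ c k - s| := by
      have h2 : ((nIso c k + e : ℕ) : ℝ) / numVertices β γ c k -
          ((nIso c k : ℝ) + nRIG β γ c k * s) / numVertices β γ c k =
          nRIG β γ c k / numVertices β γ c k * (e / nRIG β γ c k - s) := by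
        push_cast
        field_simp
        ring
      rw [h2, abs_mul, abs_of_pos (div_pos hN' hn0)]
      exact mul_le_of_le_one_left (abs_nonneg _) ((div_le_one hn0).2 hn)
    have h3 := abs_sub_le (((nIso c k + e : ℕ) : ℝ) / numVertices β γ c k)
      (((nIso c k : ℝ) + nRIG β γ c k * s) / numVertices β γ c k) (phi β γ c s)
    linarith

end RSA

theorem theorem1 (β γ c : ℝ) (hβ : 0 < β) (hγ : 0 < γ) (hc : 0 < c) :
    (∃ u w : ℝ → ℝ, RSA.IsFluidLimit β γ u w) ∧
    ∀ u w : ℝ → ℝ, RSA.IsFluidLimit β γ u w →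
      ∃ s₀ : ℝ, IsLeast {s : ℝ | s ∈ Set.Icc (0 : ℝ) 1 ∧ u s = 0} s₀ ∧
        0 ≤ RSA.phi β γ c s₀ ∧ RSA.phi β γ c s₀ ≤ 1 ∧
        ∀ ε : ℝ, 0 < ε →
          Tendsto
            (fun k : ℕ => (RSA.hittingTimeLaw β γ c k).toMeasure
              {t : ℕ | ε ≤ |(t : ℝ) / (RSA.numVertices β γ c k : ℝ) - RSA.phi β γ c s₀|})
            atTop (𝓝 0) := by
  refine ⟨⟨_, _, RSA.isFluidLimit_explicit β γ⟩, fun u w h => ?_⟩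
  obtain ⟨s₀, hs₀, ht⟩ := RSA.exists_timeAt_eq_one hβ hγ
  have hσ := RSA.sigma_pos hβ hγ hc
  have he := Real.exp_pos (-c)
  refine ⟨s₀, ⟨⟨hs₀, ?_⟩, ?_⟩, ?_, ?_, fun ε hε =>
    RSA.tendsto_hittingTimeLaw hβ hγ hσ hs₀.1 ht hε⟩
  · have h1 := h.mul_inverseRate hs₀
    rw [ht, add_eq_right] at h1
    exact (mul_eq_zero.1 h1).resolve_right (Real.exp_pos _).ne'
  -- Any zero s of u satisfies `timeAt` = 1, so it coincides with s₀.
  · rintro s ⟨hs, hus⟩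
    have h1 := h.mul_inverseRate hs
    rw [hus, zero_mul, zero_add] at h1
    have h2 := RSA.abs_sub_le_abs_timeAt_sub hβ hγ hs₀.1 hs.1
    rw [ht, h1, sub_self, abs_zero] at h2
    linarith [le_abs_self (s₀ - s)]
  · exact div_nonneg (add_nonneg he.le (mul_nonneg hσ.le hs₀.1)) (add_pos he hσ).le
  · exact (div_le_one (add_pos he hσ)).2 (by nlinarith [hs₀.2])
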